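/- Let $c_1,c_2,c_3,c_4\in\mathbb{R}^3$ be four points that are pairwise at distance $1$, and let $T=\bigcap_{i=1}^4\{x\in\mathbb{R}^3:\|x-c_i\|\le 1\}$ be the Reuleaux (spherical) tetrahedron, i.e. the intersection of the four closed unit balls centred at these points. For a unit vector $u$, let $w(T,u)=\max_{x\in T}\langle u,x\rangle-\min_{x\in T}\langle u,x\rangle$ be the width of $T$ in direction $u$ (the distance between the two supporting planes of $T$ orthogonal to $u$), and let $\mathrm{MW}(T)$ be the mean width of $T$, that is, the average of $w(T,u)$ over $u$ uniformly distributed on the unit sphere $S^2$. Let $\operatorname{arcsec}(3)=\arccos(1/3)$. Then $$\mathrm{MW}(T)=\frac{16\pi-(36-\sqrt{3}\,\pi)\operatorname{arcsec}(3)}{4\pi}=1.006582094946935\ldots,$$ that is, $1.006582094946935\le \mathrm{MW}(T)<1.006582094946936$. Moreover the minimum width $\min_{u\in S^2}w(T,u)$ is equal to $1$, the maximum width $\max_{u\in S^2}w(T,u)$ is equal to $\sqrt{3}-1/\sqrt{2}=1.0249\ldots$, and $\mathrm{MW}(T)$ lies strictly between them: $$1<\mathrm{MW}(T)<\sqrt{3}-\frac{1}{\sqrt{2}}.$$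 -/

import Mathlib

open MeasureTheory

/-- Three-dimensional Euclidean space. -/
abbrev E3 : Type := EuclideanSpace ℝ (Fin 3)

/-- The inverse secant, with its principal values: the `θ ∈ [0, π]` with `cos θ = 1 / x`,
for `|x| ≥ 1`. -/
noncomputable def arcsec (x : ℝ) : ℝ := Real.arccos (1 / x)

/-- For a nonempty compact set `K` and a unit vector `u`, the width of `K` in direction `u`: the
distance between the two supporting planes of `K` that are orthogonal to `u`. -/
noncomputable def width (K : Set E3) (u : E3) : ℝ :=
  sSup ((fun x : E3 => inner ℝ u x) '' K) - sInf ((fun x : E3 => inner ℝ u x) '' K)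

/-- The mean width of `K`: the average of the width of `K` over all directions `u`, uniformly
distributed on the unit sphere (with respect to the surface measure of the sphere, which `⨍`
normalises to total mass one). -/
noncomputable def meanWidth (K : Set E3) : ℝ :=
  ⨍ u : Metric.sphere (0 : E3) 1, width K (u : E3) ∂((volume : Measure E3).toSphere)

/-- The intersection of the four closed unit balls centred at `c 0`, `c 1`, `c 2`, `c 3`. It is
a Reuleaux tetrahedron when the centres are pairwise at distance one. -/
def ballIntersection (c : Fin 4 → E3) : Set E3 :=
  ⋂ i, Metric.closedBall (c i) 1

open Set Metric

/-! Directions `u` are sorted by the signs of the heights of the four vertices over the centroid. If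
at least three heights are `≥ 0`, or at least three are `≤ 0`, one supporting plane passes through a
vertex and the other touches the unit sphere centred at that vertex, so the width is exactly 1.
Otherwise two heights are positive and two negative, and `u` belongs to an ordered pair of opposite
edges. In a frame along the two edges and their common perpendicular, with coordinates `(a, b, z)`
of `u`, the width is then `supportProfile |a| + supportProfile |b| - z / √2`
(`width_eq_supportProfile`).

Hence the mean width is 1 plus the average of the excess over six congruent regions. Central
projection turns each region into the square `|x|, |y| < 1 / √2` (`integral_gnomonic`,
`width_sub_one_eq_gnomonic`). There the density can be replaced by one with the same symmetrization
whose inner integral is elementary; the outer integral is a combination of arctangents, evaluated by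
the angle `arccos (1 / 3)` (`integral_halfDensity`).

The extreme widths come from inequalities for `supportProfile` on the edge regions
(`one_le_supportProfile_add`, `supportProfile_add_le`). The strict inequalities for the mean follow
from its decimal bounds. -/

/-! ### Polar coordinates and central projection of the sphere -/

/-- The coordinates of a point in an orthonormal basis, the last one first. -/
theorem measurePreserving_coords (b : OrthonormalBasis (Fin 3) ℝ E3) :
    MeasurePreserving (fun x : E3 => (b.repr x 2, (b.repr x 0, b.repr x 1))) := by
  have h1 := b.measurePreserving_repr
  have h2 := PiLp.volume_preserving_ofLp (Fin 3)
  have h3 := volume_preserving_piFinSuccAbove (fun _ : Fin 3 => ℝ) 2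
  have h4 := (MeasurePreserving.id (volume : Measure ℝ)).prod (volume_preserving_finTwoArrow ℝ)
  exact ((h4.comp h3).comp h2).comp h1

theorem measurableEmbedding_coords (b : OrthonormalBasis (Fin 3) ℝ E3) :
    MeasurableEmbedding (fun x : E3 => (b.repr x 2, (b.repr x 0, b.repr x 1))) := by
  have h1 := b.repr.toHomeomorph.toMeasurableEquiv.measurableEmbedding
  have h2 := (MeasurableEquiv.toLp 2 (Fin 3 → ℝ)).symm.measurableEmbedding
  have h3 := (MeasurableEquiv.piFinSuccAbove (fun _ : Fin 3 => ℝ) 2).measurableEmbedding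
  have h4 := (((MeasurableEquiv.refl ℝ).prodCongr
    (MeasurableEquiv.finTwoArrow (α := ℝ)))).measurableEmbedding
  exact ((h4.comp h3).comp h2).comp h1

/-- Integration in polar coordinates. -/
theorem integrable_polar {Ψ : E3 → ℝ} (hΨ : Integrable Ψ) :
    Integrable (fun p : sphere (0 : E3) 1 × Ioi (0 : ℝ) => Ψ (p.2.1 • p.1.1))
      ((volume : Measure E3).toSphere.prod (Measure.volumeIoiPow 2)) ∧
    ∫ p : sphere (0 : E3) 1 × Ioi (0 : ℝ), Ψ (p.2.1 • p.1.1)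
      ∂((volume : Measure E3).toSphere.prod (Measure.volumeIoiPow 2)) = ∫ x, Ψ x := by
  have hd : Module.finrank ℝ E3 - 1 = 2 := by simp
  have hm := (volume : Measure E3).measurePreserving_homeomorphUnitSphereProd
  rw [hd] at hm
  have he := (homeomorphUnitSphereProd E3).measurableEmbedding
  have hcomp : (fun p : sphere (0 : E3) 1 × Ioi (0 : ℝ) => Ψ (p.2.1 • p.1.1)) ∘
      homeomorphUnitSphereProd E3 = fun x : ({0}ᶜ : Set E3) => Ψ x := by
    ext x
    simp only [Function.comp]
    congr 1
    exact congrArg Subtype.val ((homeomorphUnitSphereProd E3).symm_apply_apply x)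
  constructor
  · rw [← hm.integrable_comp_emb he, hcomp]
    have h := hΨ.integrableOn (s := ({0}ᶜ : Set E3))
    rwa [integrableOn_iff_comap_subtypeVal (by measurability)] at h
  · rw [← hm.integral_comp he]
    have h : ∀ x : ({0}ᶜ : Set E3), Ψ ((homeomorphUnitSphereProd E3 x).2.1 •
        (homeomorphUnitSphereProd E3 x).1.1) = Ψ x := fun x => congrFun hcomp x
    simp_rw [h]
    rw [integral_subtype_comap (measurableSet_singleton _).compl fun x ↦ Ψ x,
      restrict_compl_singleton]

/-- The cone over a plane figure at height one, cut off at height one. -/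
theorem integrable_cone {K : ℝ × ℝ → ℝ} (hK : Integrable K) (hm : Measurable K) :
    Integrable (fun q : ℝ × (ℝ × ℝ) => if q.1 ∈ Ioo (0 : ℝ) 1 then K (q.1⁻¹ • q.2) else 0) ∧
    ∫ q : ℝ × (ℝ × ℝ), (if q.1 ∈ Ioo (0 : ℝ) 1 then K (q.1⁻¹ • q.2) else 0)
      = (∫ p, K p) / 3 := by
  have hscale : ∀ F : ℝ × ℝ → ℝ, ∀ z ∈ Ioo (0 : ℝ) 1,
      ∫ p, F (z⁻¹ • p) = z ^ 2 * ∫ p, F p := by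
    intro F z hz
    rw [Measure.integral_comp_inv_smul]
    simp
  have hint : ∀ z : ℝ, ∫ p : ℝ × ℝ, (if z ∈ Ioo (0 : ℝ) 1 then K (z⁻¹ • p) else 0)
      = (Ioo (0 : ℝ) 1).indicator (fun z => z ^ 2 * ∫ p, K p) z := by
    intro z
    by_cases hz : z ∈ Ioo (0 : ℝ) 1
    · simp only [hz, if_true, indicator_of_mem, hscale K z hz]
    · simp [hz]
  have hnorm : ∀ z : ℝ, ∫ p : ℝ × ℝ, ‖(if z ∈ Ioo (0 : ℝ) 1 then K (z⁻¹ • p) else 0)‖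
      = (Ioo (0 : ℝ) 1).indicator (fun z => z ^ 2 * ∫ p, ‖K p‖) z := by
    intro z
    by_cases hz : z ∈ Ioo (0 : ℝ) 1
    · simp only [hz, if_true, indicator_of_mem, hscale (fun p => ‖K p‖) z hz]
    · simp [hz]
  have hsq : ∀ C : ℝ, Integrable ((Ioo (0 : ℝ) 1).indicator fun z : ℝ => z ^ 2 * C) := by
    intro C
    rw [integrable_indicator_iff measurableSet_Ioo]
    exact (Continuous.integrableOn_Icc (by fun_prop)).mono_set Ioo_subset_Icc_self
  have hmeas : Measurable
      (fun q : ℝ × (ℝ × ℝ) => if q.1 ∈ Ioo (0 : ℝ) 1 then K (q.1⁻¹ • q.2) else 0) := by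
    refine Measurable.ite (measurable_fst measurableSet_Ioo) (hm.comp ?_) measurable_const
    fun_prop
  have hi : Integrable
      (fun q : ℝ × (ℝ × ℝ) => if q.1 ∈ Ioo (0 : ℝ) 1 then K (q.1⁻¹ • q.2) else 0) := by
    refine (integrable_prod_iff hmeas.aestronglyMeasurable).2 ⟨.of_forall fun z => ?_, ?_⟩
    · by_cases hz : z ∈ Ioo (0 : ℝ) 1
      · simp only [hz, if_true]
        exact hK.comp_smul (inv_ne_zero hz.1.ne')
      · simp [hz]
    · simp_rw [hnorm]
      exact hsq _
  refine ⟨hi, ?_⟩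
  rw [Measure.volume_eq_prod, integral_prod _ hi]
  simp_rw [hint]
  rw [integral_indicator measurableSet_Ioo, ← integral_Ioc_eq_integral_Ioo,
    ← intervalIntegral.integral_of_le zero_le_one, intervalIntegral.integral_mul_const,
    integral_pow]
  ring

/-- The central projection of the upper half sphere onto the plane at height one. -/
theorem integral_gnomonic (b : OrthonormalBasis (Fin 3) ℝ E3) {K : ℝ × ℝ → ℝ}
    (hK : Integrable K) (hm : Measurable K) :
    Integrable (fun u : sphere (0 : E3) 1 => if 0 < b.repr u 2 then
        (b.repr u 2)⁻¹ ^ 3 * K (b.repr u 0 / b.repr u 2, b.repr u 1 / b.repr u 2) else 0)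
      (volume : Measure E3).toSphere ∧
    ∫ u : sphere (0 : E3) 1, (if 0 < b.repr u 2 then
        (b.repr u 2)⁻¹ ^ 3 * K (b.repr u 0 / b.repr u 2, b.repr u 1 / b.repr u 2) else 0)
      ∂(volume : Measure E3).toSphere = ∫ p, K p := by
  obtain ⟨h1, h2⟩ := integrable_cone hK hm
  have hc := measurePreserving_coords b
  have he := measurableEmbedding_coords b
  rw [← hc.integrable_comp_emb he] at h1
  rw [← hc.integral_comp he] at h2
  obtain ⟨h3, h4⟩ := integrable_polar h1
  -- The ray through `u` stays below height one up to radius `1 / z`, where `z` is the height of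
  -- `u`, and `K` is constant along it. So the radial integral of `r ^ 2` gives `z⁻¹ ^ 3 / 3`, and
  -- this third cancels the one in the volume of the cone.
  have hinner : ∀ u : sphere (0 : E3) 1,
      ∫ r : Ioi (0 : ℝ), ((fun q : ℝ × (ℝ × ℝ) =>
          if q.1 ∈ Ioo (0 : ℝ) 1 then K (q.1⁻¹ • q.2) else 0) ∘
          fun x : E3 => (b.repr x 2, (b.repr x 0, b.repr x 1))) (r.1 • u.1)
          ∂(Measure.volumeIoiPow 2)
        = (1 / 3) * (if 0 < b.repr u 2 then
        (b.repr u 2)⁻¹ ^ 3 * K (b.repr u 0 / b.repr u 2, b.repr u 1 / b.repr u 2) else 0) := by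
    intro u
    by_cases hz : 0 < b.repr u 2
    · have : ∀ r : Ioi (0 : ℝ), ((fun q : ℝ × (ℝ × ℝ) =>
          if q.1 ∈ Ioo (0 : ℝ) 1 then K (q.1⁻¹ • q.2) else 0) ∘
          fun x : E3 => (b.repr x 2, (b.repr x 0, b.repr x 1))) (r.1 • u.1)
          = (Iio (⟨(b.repr u 2)⁻¹, inv_pos.2 hz⟩ : Ioi (0 : ℝ))).indicator (fun _ =>
            K (b.repr u 0 / b.repr u 2, b.repr u 1 / b.repr u 2)) r := by
        rintro ⟨r, hr⟩
        have hr' : 0 < r := hr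
        have e1 : r * b.repr u 2 < 1 ↔ r < (b.repr u 2)⁻¹ := by
          rw [lt_inv_comm₀ hr' hz, ← one_div, lt_div_iff₀ hr', mul_comm]
        have e2 : ∀ t, (r * b.repr u 2)⁻¹ * (r * t) = t / b.repr u 2 := by
          intro t; field_simp
        simp only [Function.comp, map_smul, PiLp.smul_apply, smul_eq_mul, mem_Ioo,
          mul_pos hr' hz, true_and, Prod.smul_mk, e2, indicator, mem_Iio, e1]
        rfl
      simp_rw [this]
      rw [integral_indicator measurableSet_Iio, setIntegral_const, measureReal_def,
        Measure.volumeIoiPow_apply_Iio, ENNReal.toReal_ofReal (by positivity)]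
      simp only [hz, if_true, smul_eq_mul]
      norm_num
      ring
    · have : ∀ r : Ioi (0 : ℝ), ((fun q : ℝ × (ℝ × ℝ) =>
          if q.1 ∈ Ioo (0 : ℝ) 1 then K (q.1⁻¹ • q.2) else 0) ∘
          fun x : E3 => (b.repr x 2, (b.repr x 0, b.repr x 1))) (r.1 • u.1) = 0 := by
        rintro ⟨r, hr⟩
        have hr' : 0 < r := hr
        have : ¬ 0 < r * b.repr u 2 := by
          rw [mul_pos_iff_of_pos_left hr']; exact hz
        simp only [Function.comp, map_smul, PiLp.smul_apply, smul_eq_mul, mem_Ioo, this,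
          false_and, if_false]
      simp_rw [this]
      simp [hz]
  have h5 := h3.integral_prod_left
  rw [integral_prod _ h3] at h4
  simp_rw [hinner] at h5 h4
  rw [integral_const_mul] at h4
  refine ⟨?_, ?_⟩
  · convert h5.const_mul 3 using 2
    ring
  · have h2' := h4.trans h2
    linarith

/-! ### Support values on spherical faces and circular edges -/

theorem mem_ballIntersection {c : Fin 4 → E3} {x : E3} :
    x ∈ ballIntersection c ↔ ∀ i, ‖x - c i‖ ≤ 1 := by
  simp [ballIntersection, dist_eq_norm]

theorem ballIntersection_comp_perm (c : Fin 4 → E3) (σ : Equiv.Perm (Fin 4)) :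
    ballIntersection (c ∘ σ) = ballIntersection c := by
  ext x
  simp only [mem_ballIntersection, Function.comp]
  exact σ.forall_congr_right (q := fun i => ‖x - c i‖ ≤ 1)

/-- The width in direction `u` from the values of the support function at `u` and `-u`. -/
theorem width_eq_add {K : Set E3} {u : E3} {M M' : ℝ}
    (h : IsGreatest ((fun x : E3 => inner ℝ u x) '' K) M)
    (h' : IsGreatest ((fun x : E3 => inner ℝ (-u) x) '' K) M') : width K u = M + M' := by
  have hl : IsLeast ((fun x : E3 => inner ℝ u x) '' K) (-M') := by
    constructor
    · obtain ⟨x, hx, hx'⟩ := h'.1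
      refine ⟨x, hx, ?_⟩
      simp only [inner_neg_left] at hx'
      simp [← hx']
    · rintro _ ⟨x, hx, rfl⟩
      have := h'.2 ⟨x, hx, rfl⟩
      simp only [inner_neg_left] at this
      simp only
      linarith
  rw [width, h.csSup_eq, hl.csInf_eq]
  ring

/-- A support value at a point `c k + u` in the relative interior of a spherical face or on its
boundary. -/
theorem isGreatest_face {c : Fin 4 → E3} (hc : ∀ i j, i ≠ j → dist (c i) (c j) = 1) {u : E3}
    (hu : ‖u‖ = 1) (k : Fin 4) (h : ∀ j, j ≠ k → 1 / 2 ≤ inner ℝ u (c j - c k)) :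
    IsGreatest ((fun x : E3 => inner ℝ u x) '' ballIntersection c) (inner ℝ u (c k) + 1) := by
  constructor
  · refine ⟨c k + u, mem_ballIntersection.2 fun j => ?_, ?_⟩
    · by_cases hj : j = k
      · simp [hj, hu]
      · have h1 : ‖u - (c j - c k)‖ ^ 2 ≤ 1 := by
          rw [norm_sub_sq_real, ← dist_eq_norm (c j), hc j k hj, hu]
          linarith [h j hj]
        rw [show c k + u - c j = u - (c j - c k) by abel]
        nlinarith [norm_nonneg (u - (c j - c k))]
    · simp [inner_add_right, hu]
  · rintro _ ⟨x, hx, rfl⟩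
    have h1 := real_inner_le_norm u (x - c k)
    have h2 := mem_ballIntersection.1 hx k
    rw [inner_sub_right, hu] at h1
    simp only
    linarith

/-- A support value at a point of a circular edge. -/
theorem isGreatest_edge {c : Fin 4 → E3} {p : E3} (hp : p ∈ ballIntersection c) {k l : Fin 4}
    (hk : ‖p - c k‖ = 1) (hl : ‖p - c l‖ = 1) {lam mu : ℝ} (hlam : 0 ≤ lam) (hmu : 0 ≤ mu) {u : E3}
    (hu : u = lam • (p - c k) + mu • (p - c l)) :
    IsGreatest ((fun x : E3 => inner ℝ u x) '' ballIntersection c) (inner ℝ u p) := by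
  refine ⟨⟨p, hp, rfl⟩, ?_⟩
  rintro _ ⟨x, hx, rfl⟩
  -- Each ball with `p` on its boundary lies behind its tangent plane at `p`, so the vectors `p - c
  -- i` are outer normals at `p`, and so are their nonnegative combinations.
  have key : ∀ i, ‖p - c i‖ = 1 → inner ℝ (p - c i) (x - p) ≤ 0 := by
    intro i hi
    have h1 := real_inner_le_norm (p - c i) (x - c i)
    have h2 := mem_ballIntersection.1 hx i
    have h3 := real_inner_self_eq_norm_sq (p - c i)
    rw [show x - p = (x - c i) - (p - c i) by abel, inner_sub_right, h3, hi]
    rw [hi] at h1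
    linarith
  have h1 : inner ℝ u (x - p) ≤ 0 := by
    rw [hu, inner_add_left, inner_smul_left, inner_smul_left]
    have := mul_nonneg hlam (neg_nonneg.2 (key k hk))
    have := mul_nonneg hmu (neg_nonneg.2 (key l hl))
    simp only [conj_trivial]
    linarith
  rw [inner_sub_right] at h1
  simp only
  linarith

/-! ### Vertex heights and the directions of width one -/

/-- The height of the vertex `c t` over the centroid in direction `u`. -/
noncomputable def vertexHeight (c : Fin 4 → E3) (u : E3) (t : Fin 4) : ℝ :=
  inner ℝ u (c t) - (∑ s, inner ℝ u (c s)) / 4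

theorem vertexHeight_comp_perm (c : Fin 4 → E3) (σ : Equiv.Perm (Fin 4)) (u : E3) (t : Fin 4) :
    vertexHeight (c ∘ σ) u t = vertexHeight c u (σ t) := by
  simp only [vertexHeight, Function.comp]
  rw [Equiv.sum_comp σ (fun s => inner ℝ u (c s))]

theorem sum_vertexHeight (c : Fin 4 → E3) (u : E3) : ∑ t, vertexHeight c u t = 0 := by
  simp only [vertexHeight, Fin.sum_univ_four]
  ring

theorem vertexHeight_neg (c : Fin 4 → E3) (u : E3) (t : Fin 4) :
    vertexHeight c (-u) t = - vertexHeight c u t := by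
  simp only [vertexHeight, Fin.sum_univ_four, inner_neg_left]
  ring

theorem inner_sub_eq_vertexHeight (c : Fin 4 → E3) (u : E3) (j k : Fin 4) :
    inner ℝ u (c j - c k) = vertexHeight c u j - vertexHeight c u k := by
  simp only [vertexHeight, inner_sub_right]
  ring

/-- Two opposite edges of a regular tetrahedron are in the directions of two vectors of an
orthonormal basis whose third vector points from the middle of one to the middle of the other. -/
theorem exists_frame {c : Fin 4 → E3} (hc : ∀ i j, i ≠ j → dist (c i) (c j) = 1) :
    ∃ (b : OrthonormalBasis (Fin 3) ℝ E3) (m : E3),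
      c 0 = m - (1 / 2 : ℝ) • b 0 ∧ c 1 = m + (1 / 2 : ℝ) • b 0 ∧
      c 2 = m + (√2)⁻¹ • b 2 - (1 / 2 : ℝ) • b 1 ∧ c 3 = m + (√2)⁻¹ • b 2 + (1 / 2 : ℝ) • b 1 := by
  have h2 : (√2)⁻¹ * (√2)⁻¹ = (1 / 2 : ℝ) := by
    rw [← mul_inv, Real.mul_self_sqrt (by norm_num)]; norm_num
  -- The third vector is `√2` times the difference of the midpoints of the two edges, whose distance
  -- is `1 / √2`.
  obtain ⟨v, hv⟩ : ∃ v : Fin 3 → E3, v = ![c 1 - c 0, c 3 - c 2,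
      (√2)⁻¹ • ((c 2 - c 0) + (c 3 - c 0) - (c 1 - c 0))] := ⟨_, rfl⟩
  have hn : ∀ i, i ≠ 0 → inner ℝ (c i - c 0) (c i - c 0) = 1 := by
    intro i hi
    rw [real_inner_self_eq_norm_sq, ← dist_eq_norm, hc i 0 hi]; norm_num
  have hh : ∀ i j, i ≠ 0 → j ≠ 0 → i ≠ j → inner ℝ (c i - c 0) (c j - c 0) = 1 / 2 := by
    intro i j hi hj hij
    rw [real_inner_eq_norm_mul_self_add_norm_mul_self_sub_norm_sub_mul_self_div_two,
      sub_sub_sub_cancel_right, ← dist_eq_norm, ← dist_eq_norm, ← dist_eq_norm, hc i 0 hi, hc j 0 hj,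
      hc i j hij]
    norm_num
  have h11 := hn 1 (by decide)
  have h22 := hn 2 (by decide)
  have h33 := hn 3 (by decide)
  have h12 := hh 1 2 (by decide) (by decide) (by decide)
  have h13 := hh 1 3 (by decide) (by decide) (by decide)
  have h23 := hh 2 3 (by decide) (by decide) (by decide)
  have h21 := hh 2 1 (by decide) (by decide) (by decide)
  have h31 := hh 3 1 (by decide) (by decide) (by decide)
  have h32 := hh 3 2 (by decide) (by decide) (by decide)
  have e32 : c 3 - c 2 = (c 3 - c 0) - (c 2 - c 0) := by abel
  have hon : Orthonormal ℝ v := by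
    rw [orthonormal_iff_ite]
    intro i j
    subst hv
    rw [e32]
    generalize c 1 - c 0 = x1 at *
    generalize c 2 - c 0 = x2 at *
    generalize c 3 - c 0 = x3 at *
    fin_cases i <;> fin_cases j <;>
      simp [inner_sub_left, inner_sub_right, inner_add_left, inner_add_right, inner_smul_left,
        inner_smul_right, h11, h22, h33, h12, h13, h23, h21, h31, h32, -mul_eq_zero,
        -inner_self_eq_norm_sq_to_K] <;> try norm_num
    linear_combination 2 * h2
  have hcard : Fintype.card (Fin 3) = Module.finrank ℝ E3 := by simp
  obtain ⟨b, hb⟩ : ∃ b : OrthonormalBasis (Fin 3) ℝ E3, ⇑b = v :=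
    ⟨(basisOfOrthonormalOfCardEqFinrank hon hcard).toOrthonormalBasis (by simpa using hon), by simp⟩
  have hb0 : b 0 = c 1 - c 0 := by rw [hb, hv]; rfl
  have hb1 : b 1 = c 3 - c 2 := by rw [hb, hv]; rfl
  have hb2 : (√2)⁻¹ • b 2 = (1 / 2 : ℝ) • ((c 2 - c 0) + (c 3 - c 0) - (c 1 - c 0)) := by
    rw [hb, hv, ← h2, ← smul_smul]; rfl
  refine ⟨b, (1 / 2 : ℝ) • (c 0 + c 1), ?_⟩
  rw [hb0, hb1, hb2]
  refine ⟨?_, ?_, ?_, ?_⟩ <;> module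

/-- By symmetry of the regular tetrahedron, the sum of `⟨u, c t - g⟩ • (c t - g)` over the vertices,
with `g` the centroid, is a fixed multiple of `u`. For edge length 1 the multiple is `1 / 2`, and
`g` drops out because the heights sum to zero. -/
theorem eq_sum_vertexHeight {c : Fin 4 → E3} (hc : ∀ i j, i ≠ j → dist (c i) (c j) = 1) (u : E3) :
    u = (2 : ℝ) • ∑ t, vertexHeight c u t • c t := by
  obtain ⟨b, m, h0, h1, h2, h3⟩ := exists_frame hc
  have hs : (√2)⁻¹ * (√2)⁻¹ = (1 / 2 : ℝ) := by
    rw [← mul_inv, Real.mul_self_sqrt (by norm_num)]; norm_num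
  have hsum := sum_vertexHeight c u
  have d1 := inner_sub_eq_vertexHeight c u 1 0
  have d2 := inner_sub_eq_vertexHeight c u 3 2
  have d3 := inner_sub_eq_vertexHeight c u 2 0
  rw [h1, h0, show m + (1 / 2 : ℝ) • b 0 - (m - (1 / 2 : ℝ) • b 0) = b 0 by module] at d1
  rw [h3, h2, show m + (√2)⁻¹ • b 2 + (1 / 2 : ℝ) • b 1 -
    (m + (√2)⁻¹ • b 2 - (1 / 2 : ℝ) • b 1) = b 1 by module] at d2
  rw [h2, h0, show m + (√2)⁻¹ • b 2 - (1 / 2 : ℝ) • b 1 - (m - (1 / 2 : ℝ) • b 0)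
    = (√2)⁻¹ • b 2 - (1 / 2 : ℝ) • b 1 + (1 / 2 : ℝ) • b 0 by module, inner_add_right,
    inner_sub_right, inner_smul_right, inner_smul_right, inner_smul_right] at d3
  have hexp := b.sum_repr' u
  rw [Fin.sum_univ_three] at hexp
  simp only [real_inner_comm _ u] at hexp d1 d2 d3
  rw [Fin.sum_univ_four] at hsum
  rw [Fin.sum_univ_four, h0, h1, h2, h3]
  generalize vertexHeight c u 0 = q0 at *
  generalize vertexHeight c u 1 = q1 at *
  generalize vertexHeight c u 2 = q2 at *
  generalize vertexHeight c u 3 = q3 at *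
  obtain rfl : q3 = -(q0 + q1 + q2) := by linarith
  generalize inner ℝ (b 0) u = x at *
  generalize inner ℝ (b 1) u = y at *
  generalize inner ℝ (b 2) u = z at *
  generalize (√2)⁻¹ = s at *
  obtain rfl : z = s * (-2 * (q0 + q1)) := by linear_combination (-2 * z) * hs + 2 * s * d3 + s * d2 - s * d1
  rw [← hexp, d1, d2]
  module

/-- If `u` is in the cone spanned by the three edges at a vertex, then the width in direction `u`
is one. -/
theorem width_eq_one_of_nonneg {c : Fin 4 → E3} (hc : ∀ i j, i ≠ j → dist (c i) (c j) = 1) {u : E3}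
    (hu : ‖u‖ = 1) (k : Fin 4) (h : ∀ j, j ≠ k → 0 ≤ vertexHeight c u j) :
    width (ballIntersection c) u = 1 := by
  have hrep : u = (2 : ℝ) • ∑ t, vertexHeight c u t • (c t - c k) := by
    conv_lhs => rw [eq_sum_vertexHeight hc u]
    simp only [smul_sub, Finset.sum_sub_distrib, ← Finset.sum_smul, sum_vertexHeight]
    simp
  have hsum := sum_vertexHeight c u
  rw [← Finset.add_sum_erase _ _ (Finset.mem_univ k)] at hsum
  -- Triangle inequality in `hrep`, the edges at `c k` being unit vectors. It pushes the height of
  -- `c k` down to at most `-1 / 2`, which is what `isGreatest_face` needs.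
  have hone : 1 ≤ 2 * ∑ t ∈ Finset.univ.erase k, vertexHeight c u t := by
    rw [← hu]
    conv_lhs => rw [hrep]
    rw [norm_smul, Real.norm_two, ← Finset.add_sum_erase _ _ (Finset.mem_univ k), sub_self,
      smul_zero, zero_add]
    gcongr
    refine (norm_sum_le _ _).trans (Finset.sum_le_sum fun t ht => ?_)
    have ht' := Finset.ne_of_mem_erase ht
    rw [norm_smul, ← dist_eq_norm, hc t k ht', mul_one, Real.norm_of_nonneg (h t ht')]
  have hk : vertexHeight c u k ≤ -(1 / 2) := by linarith
  have h1 := isGreatest_face hc hu k fun j hj => by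
    rw [inner_sub_eq_vertexHeight]
    linarith [h j hj]
  have h2 : IsGreatest ((fun x : E3 => inner ℝ (-u) x) '' ballIntersection c)
      (inner ℝ (-u) (c k)) := by
    refine ⟨⟨c k, mem_ballIntersection.2 fun j => ?_, rfl⟩, ?_⟩
    · by_cases hj : k = j
      · simp [hj]
      · rw [← dist_eq_norm, hc k j hj]
    -- A point within distance 1 of `c t` satisfies `2 * ⟨c t - c k, x - c k⟩ ≥ ‖x - c k‖ ^ 2`,
    -- hence lies on the inner side of `c k` along every edge.
    · rintro _ ⟨x, hx, rfl⟩
      have hin : ∀ t, 0 ≤ inner ℝ (c t - c k) (x - c k) := by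
        intro t
        by_cases ht : t = k
        · simp [ht]
        have h3 : ‖(x - c k) - (c t - c k)‖ ≤ 1 := by
          rw [sub_sub_sub_cancel_right]; exact mem_ballIntersection.1 hx t
        have h4 := norm_sub_sq_real (x - c k) (c t - c k)
        rw [← dist_eq_norm (c t), hc t k ht, real_inner_comm] at h4
        nlinarith [norm_nonneg ((x - c k) - (c t - c k)), sq_nonneg ‖x - c k‖]
      have h5 : 0 ≤ inner ℝ u (x - c k) := by
        rw [hrep, inner_smul_left, sum_inner]
        refine mul_nonneg (by norm_num) (Finset.sum_nonneg fun t _ => ?_)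
        by_cases ht : t = k
        · simp [ht]
        · rw [inner_smul_left]
          exact mul_nonneg (h t ht) (hin t)
      rw [inner_sub_right] at h5
      simp only [inner_neg_left]
      linarith
  rw [width_eq_add h1 h2, inner_neg_left]
  ring

theorem width_neg (K : Set E3) (u : E3) : width K (-u) = width K u := by
  have h : (fun x : E3 => inner ℝ (-u) x) '' K = -((fun x : E3 => inner ℝ u x) '' K) := by
    ext t
    simp only [mem_image, Set.mem_neg, inner_neg_left, neg_eq_iff_eq_neg]
  rw [width, width, h, Real.sSup_neg, Real.sInf_neg]
  ring

theorem width_eq_one_of_nonpos {c : Fin 4 → E3} (hc : ∀ i j, i ≠ j → dist (c i) (c j) = 1) {u : E3}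
    (hu : ‖u‖ = 1) (k : Fin 4) (h : ∀ j, j ≠ k → vertexHeight c u j ≤ 0) :
    width (ballIntersection c) u = 1 := by
  rw [← width_neg]
  refine width_eq_one_of_nonneg hc (by rwa [norm_neg]) k fun j hj => ?_
  rw [vertexHeight_neg]
  linarith [h j hj]

/-! ### The width over the directions of a pair of opposite edges -/

/-- The height over the middle of an edge at which a plane touches the two spherical faces that
meet in the opposite edge, `s` being the sine of its inclination. -/
noncomputable def supportProfile (s : ℝ) : ℝ :=
  if s ≤ 1 / 2 then √3 / 2 * √(1 - s ^ 2) else 1 - s / 2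

set_option maxHeartbeats 800000 in
/-- The support function over the region of directions that belongs to an edge. -/
theorem isGreatest_supportProfile {c : Fin 4 → E3} (hc : ∀ i j, i ≠ j → dist (c i) (c j) = 1)
    {e₁ e₂ e₃ m : E3} (he : ∀ x y z x' y' z' : ℝ, inner ℝ (x • e₁ + y • e₂ + z • e₃)
      (x' • e₁ + y' • e₂ + z' • e₃) = x * x' + y * y' + z * z') {i j k l : Fin 4}
    (hall : ∀ t, t = i ∨ t = j ∨ t = k ∨ t = l)
    (hi : c i = m - (1 / 2 : ℝ) • e₁) (hj : c j = m + (1 / 2 : ℝ) • e₁)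
    (hk : c k = m + (√2)⁻¹ • e₃ - (1 / 2 : ℝ) • e₂) (hl : c l = m + (√2)⁻¹ • e₃ + (1 / 2 : ℝ) • e₂)
    {a b z : ℝ} (hu : a ^ 2 + b ^ 2 + z ^ 2 = 1) (ha : √2 * |a| ≤ z) (hb : √2 * |b| ≤ z) :
    IsGreatest ((fun x : E3 => inner ℝ (a • e₁ + b • e₂ + z • e₃) x) '' ballIntersection c)
      (inner ℝ (a • e₁ + b • e₂ + z • e₃) m + supportProfile |a|) := by
  have h2 : (√2)⁻¹ * √2 = 1 := inv_mul_cancel₀ (by positivity)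
  have h22 : √2 * √2 = 2 := Real.mul_self_sqrt (by norm_num)
  have hs0 : 0 < (√2)⁻¹ := by positivity
  have hss : (√2)⁻¹ * (√2)⁻¹ = (1 / 2 : ℝ) := by
    rw [← mul_inv, h22]; norm_num
  have ha' : |a| ≤ (√2)⁻¹ * z := by
    calc |a| = (√2)⁻¹ * (√2 * |a|) := by rw [← mul_assoc, h2, one_mul]
      _ ≤ _ := by gcongr
  have hb' : |b| ≤ (√2)⁻¹ * z := by
    calc |b| = (√2)⁻¹ * (√2 * |b|) := by rw [← mul_assoc, h2, one_mul]
      _ ≤ _ := by gcongr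
  generalize (√2)⁻¹ = s at *
  have hz0 : 0 ≤ z := by
    have := abs_nonneg a
    by_contra! hlt
    nlinarith
  have hnorm : ∀ x y z : ℝ, ‖x • e₁ + y • e₂ + z • e₃‖ ^ 2 = x ^ 2 + y ^ 2 + z ^ 2 := by
    intro x y z
    rw [← real_inner_self_eq_norm_sq, he]; ring
  have hun : ‖a • e₁ + b • e₂ + z • e₃‖ = 1 := by
    rw [← sq_eq_sq₀ (norm_nonneg _) zero_le_one, hnorm, hu]; norm_num
  by_cases hsmall : |a| ≤ 1 / 2
  · have ha2 : a ^ 2 ≤ 1 / 4 := by rw [← sq_abs]; nlinarith [abs_nonneg a]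
    obtain ⟨q, hq⟩ : ∃ q, q = √(1 - a ^ 2) := ⟨_, rfl⟩
    have hqq : q * q = 1 - a ^ 2 := by rw [hq]; exact Real.mul_self_sqrt (by linarith)
    have hq0 : 0 < q := by rw [hq]; exact Real.sqrt_pos.2 (by linarith)
    obtain ⟨r, hr⟩ : ∃ r, r = √3 := ⟨_, rfl⟩
    have hrr : r * r = 3 := by rw [hr]; exact Real.mul_self_sqrt (by linarith)
    have hr0 : 0 < r := by rw [hr]; positivity
    -- The spheres around `c i` and `c j` meet in the circle of radius `√3 / 2` about `m` in the
    -- plane of `e₂`, `e₃`. The factor `κ` scales the projection `b • e₂ + z • e₃` of `u`, of length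
    -- `q`, onto this circle.
    obtain ⟨κ, hκ⟩ : ∃ κ, κ = r / (2 * q) := ⟨_, rfl⟩
    have hκq : κ * q = r / 2 := by rw [hκ]; field_simp
    have hκ0 : 0 < κ := by rw [hκ]; positivity
    have hκκ : κ * κ * (1 - a ^ 2) = 3 / 4 := by
      linear_combination (κ * q + r / 2) * hκq + hrr / 4 - κ * κ * hqq
    have hn1 : ∀ ε : ℝ, ε ^ 2 = 1 / 4 → ‖ε • e₁ + (κ * b) • e₂ + (κ * z) • e₃‖ = 1 := by
      intro ε hε
      rw [← sq_eq_sq₀ (norm_nonneg _) zero_le_one, hnorm]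
      linear_combination hε + hκκ + κ ^ 2 * hu
    -- This puts the contact point in the other two balls: the squared distances to their centres
    -- are at most `3 / 2 - κ * z * s`. It holds since `b ^ 2 ≤ z ^ 2 / 2` forces `z ^ 2 ≥ 2 / 3 *
    -- (1 - a ^ 2)`.
    have hin : 1 / 2 ≤ κ * z * s := by
      have hbz : b ^ 2 ≤ z ^ 2 / 2 := by
        rw [← sq_abs b]
        nlinarith [abs_nonneg b, mul_nonneg hs0.le hz0]
      have : 1 / 4 ≤ (κ * z * s) ^ 2 := by
        have : (κ * z * s) ^ 2 = κ ^ 2 * z ^ 2 / 2 := by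
          linear_combination κ ^ 2 * z ^ 2 * hss
        rw [this]
        nlinarith [mul_nonneg hκ0.le hκ0.le]
      nlinarith [mul_nonneg (mul_nonneg hκ0.le hz0) hs0.le]
    have hpi : ‖m + (κ * b) • e₂ + (κ * z) • e₃ - c i‖ = 1 := by
      refine Eq.trans ?_ (hn1 (1 / 2) (by norm_num))
      rw [hi]
      congr 1
      module
    have hpj : ‖m + (κ * b) • e₂ + (κ * z) • e₃ - c j‖ = 1 := by
      refine Eq.trans ?_ (hn1 (-(1 / 2)) (by norm_num))
      rw [hj]
      congr 1
      module
    have hp : m + (κ * b) • e₂ + (κ * z) • e₃ ∈ ballIntersection c := by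
      have hkl : ∀ ε : ℝ, ε ^ 2 = 1 / 4 → (ε = 1 / 2 ∨ ε = -(1 / 2)) →
          ‖(0 : ℝ) • e₁ + (κ * b + ε) • e₂ + (κ * z - s) • e₃‖ ≤ 1 := by
        intro ε hε hε'
        have hb2 : |κ * b| ≤ κ * z * s := by
          rw [abs_mul, abs_of_pos hκ0, mul_assoc, mul_comm z s]
          gcongr
        have hb3 : 2 * (ε * (κ * b)) ≤ |κ * b| := by
          rcases hε' with h | h <;> rw [h]
          · linarith [le_abs_self (κ * b)]
          · linarith [neg_le_abs (κ * b)]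
        have h1 : ‖(0 : ℝ) • e₁ + (κ * b + ε) • e₂ + (κ * z - s) • e₃‖ ^ 2 ≤ 1 := by
          rw [hnorm]
          have : (0 : ℝ) ^ 2 + (κ * b + ε) ^ 2 + (κ * z - s) ^ 2
              = 3 / 2 + 2 * (ε * (κ * b)) - 2 * (κ * z * s) := by
            linear_combination hε + hκκ + κ ^ 2 * hu + hss
          linarith
        rwa [sq_le_one_iff₀ (norm_nonneg _)] at h1
      rw [mem_ballIntersection]
      intro t
      rcases hall t with rfl | rfl | rfl | rfl
      · exact hpi.le
      · exact hpj.le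
      · rw [hk]
        refine le_of_eq_of_le ?_ (hkl (1 / 2) (by norm_num) (by norm_num))
        congr 1
        module
      · rw [hl]
        refine le_of_eq_of_le ?_ (hkl (-(1 / 2)) (by norm_num) (by norm_num))
        congr 1
        module
    -- Nonnegativity of the two multipliers of the normals. It amounts to `3 * a ^ 2 ≤ 1 - a ^ 2`,
    -- that is `|a| ≤ 1 / 2`: beyond this the contact point leaves the edge for a face.
    have hqa : |a| ≤ q / r := by
      rw [le_div_iff₀ hr0, ← sq_le_sq₀ (by positivity) hq0.le, mul_pow, sq_abs]
      nlinarith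
    have hqr : q / r * κ = 1 / 2 := by
      rw [hκ]; field_simp
    have key := isGreatest_edge hp (k := i) (l := j)
      hpi hpj
      (lam := q / r + a) (mu := q / r - a) (by linarith [neg_abs_le a]) (by linarith [le_abs_self a])
      (u := a • e₁ + b • e₂ + z • e₃)
      (by
        rw [hi, hj]
        generalize q / r = w at *
        have e1 : b = 2 * (w * κ) * b := by rw [hqr]; ring
        have e2 : z = 2 * (w * κ) * z := by rw [hqr]; ring
        nth_rewrite 1 [e1, e2]
        module)
    convert key using 1
    rw [supportProfile, if_pos hsmall, sq_abs, ← hq, ← hr, add_assoc m, inner_add_right,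
      show (κ * b) • e₂ + (κ * z) • e₃ = (0 : ℝ) • e₁ + (κ * b) • e₂ + (κ * z) • e₃ by module, he]
    have : κ * (q * q) = r / 2 * q := by rw [← hκq]; ring
    linear_combination -this + κ * hqq - κ * hu
  · rw [supportProfile, if_neg hsmall]
    push Not at hsmall
    -- From `a ^ 2 > 1 / 4` and `z ^ 2 ≥ 2 * a ^ 2`, little is left for `b ^ 2`. So `|b| ≤ |a|`, as
    -- the face conditions at the two far vertices require.
    have hb2 : |b| ≤ 1 / 2 := by
      have : |a| ^ 2 ≤ z ^ 2 / 2 := by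
        nlinarith [abs_nonneg a, mul_nonneg hs0.le hz0]
      have := sq_abs a
      have := sq_abs b
      nlinarith [abs_nonneg b]
    have hval : ∀ ε δ : ℝ, inner ℝ (a • e₁ + b • e₂ + z • e₃)
        (ε • e₁ + δ • e₂ + s • e₃) = a * ε + b * δ + s * z := by
      intro ε δ
      rw [he]; ring
    have hval' : ∀ ε : ℝ, inner ℝ (a • e₁ + b • e₂ + z • e₃) (ε • e₁) = ε * a := by
      intro ε
      rw [show ε • e₁ = ε • e₁ + (0 : ℝ) • e₂ + (0 : ℝ) • e₃ by module, he]; ring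
    rcases le_or_gt 0 a with hpos | hneg
    · rw [abs_of_nonneg hpos] at *
      convert isGreatest_face hc hun i ?_ using 1
      · rw [hi, inner_sub_right, hval']; ring
      · intro t ht
        rcases hall t with rfl | rfl | rfl | rfl
        · exact absurd rfl ht
        · rw [hi, hj, show m + (1 / 2 : ℝ) • e₁ - (m - (1 / 2 : ℝ) • e₁) = (1 : ℝ) • e₁ by module,
            hval']
          linarith
        · rw [hi, hk, show m + s • e₃ - (1 / 2 : ℝ) • e₂ - (m - (1 / 2 : ℝ) • e₁)
            = (1 / 2 : ℝ) • e₁ + (-(1 / 2) : ℝ) • e₂ + s • e₃ by module, hval]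
          linarith [le_abs_self b]
        · rw [hi, hl, show m + s • e₃ + (1 / 2 : ℝ) • e₂ - (m - (1 / 2 : ℝ) • e₁)
            = (1 / 2 : ℝ) • e₁ + (1 / 2 : ℝ) • e₂ + s • e₃ by module, hval]
          linarith [neg_abs_le b]
    · rw [abs_of_neg hneg] at *
      convert isGreatest_face hc hun j ?_ using 1
      · rw [hj, inner_add_right, hval']; ring
      · intro t ht
        rcases hall t with rfl | rfl | rfl | rfl
        · rw [hi, hj, show m - (1 / 2 : ℝ) • e₁ - (m + (1 / 2 : ℝ) • e₁) = (-1 : ℝ) • e₁ by module,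
            hval']
          linarith
        · exact absurd rfl ht
        · rw [hj, hk, show m + s • e₃ - (1 / 2 : ℝ) • e₂ - (m + (1 / 2 : ℝ) • e₁)
            = (-(1 / 2) : ℝ) • e₁ + (-(1 / 2) : ℝ) • e₂ + s • e₃ by module, hval]
          linarith [le_abs_self b]
        · rw [hj, hl, show m + s • e₃ + (1 / 2 : ℝ) • e₂ - (m + (1 / 2 : ℝ) • e₁)
            = (-(1 / 2) : ℝ) • e₁ + (1 / 2 : ℝ) • e₂ + s • e₃ by module, hval]
          linarith [neg_abs_le b]

/-- The width over the region of directions that belongs to a pair of opposite edges. -/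
theorem width_eq_supportProfile {c : Fin 4 → E3} (hc : ∀ i j, i ≠ j → dist (c i) (c j) = 1)
    {b : OrthonormalBasis (Fin 3) ℝ E3} {m : E3} {i j k l : Fin 4}
    (hall : ∀ t, t = i ∨ t = j ∨ t = k ∨ t = l)
    (hi : c i = m - (1 / 2 : ℝ) • b 0) (hj : c j = m + (1 / 2 : ℝ) • b 0)
    (hk : c k = m + (√2)⁻¹ • b 2 - (1 / 2 : ℝ) • b 1)
    (hl : c l = m + (√2)⁻¹ • b 2 + (1 / 2 : ℝ) • b 1)
    {u : E3} (hu : ‖u‖ = 1) (h0 : √2 * |b.repr u 0| ≤ b.repr u 2)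
    (h1 : √2 * |b.repr u 1| ≤ b.repr u 2) :
    width (ballIntersection c) u =
      supportProfile |b.repr u 0| + supportProfile |b.repr u 1| - (√2)⁻¹ * b.repr u 2 := by
  have hexp := b.sum_repr u
  rw [Fin.sum_univ_three] at hexp
  have hin : ∀ i j, inner ℝ (b i) (b j) = if i = j then (1 : ℝ) else 0 :=
    orthonormal_iff_ite.1 b.orthonormal
  have he : ∀ x y z x' y' z' : ℝ, inner ℝ (x • b 0 + y • b 1 + z • b 2)
      (x' • b 0 + y' • b 1 + z' • b 2) = x * x' + y * y' + z * z' := by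
    intro x y z x' y' z'
    simp only [inner_add_left, inner_add_right, inner_smul_left, inner_smul_right, hin]
    simp
    ring
  have hsq : b.repr u 0 ^ 2 + b.repr u 1 ^ 2 + b.repr u 2 ^ 2 = 1 := by
    have := he (b.repr u 0) (b.repr u 1) (b.repr u 2) (b.repr u 0) (b.repr u 1) (b.repr u 2)
    rw [hexp, real_inner_self_eq_norm_sq, hu] at this
    linarith
  generalize b.repr u 0 = x at *
  generalize b.repr u 1 = y at *
  generalize b.repr u 2 = z at *
  have g1 := isGreatest_supportProfile hc he hall hi hj hk hl hsq h0 h1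
  -- The frame seen from the opposite edge: the edge directions are exchanged and the perpendicular
  -- reversed. The same lemma at `-u` then gives the second supporting plane.
  have he' : ∀ x y z x' y' z' : ℝ, inner ℝ (x • b 1 + y • b 0 + z • (-b 2))
      (x' • b 1 + y' • b 0 + z' • (-b 2)) = x * x' + y * y' + z * z' := by
    intro x y z x' y' z'
    rw [show x • b 1 + y • b 0 + z • (-b 2) = y • b 0 + x • b 1 + (-z) • b 2 by module,
      show x' • b 1 + y' • b 0 + z' • (-b 2) = y' • b 0 + x' • b 1 + (-z') • b 2 by module, he]
    ring
  have g2 := isGreatest_supportProfile hc he' (i := k) (j := l) (k := i) (l := j)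
    (m := m + (√2)⁻¹ • b 2) (a := -y) (b := -x) (z := z)
    (fun t => by rcases hall t with h | h | h | h <;> simp [h]) hk hl (by rw [hi]; module)
    (by rw [hj]; module) (by linarith) (by rwa [abs_neg]) (by rwa [abs_neg])
  have hneg : (-y) • b 1 + (-x) • b 0 + z • (-b 2) = -u := by
    rw [← hexp]; module
  rw [hneg] at g2
  rw [hexp] at g1
  rw [width_eq_add g1 g2, abs_neg, inner_neg_left, inner_add_right]
  have : inner ℝ u ((√2)⁻¹ • b 2) = (√2)⁻¹ * z := by
    rw [← hexp, show (√2)⁻¹ • b 2 = (0 : ℝ) • b 0 + (0 : ℝ) • b 1 + (√2)⁻¹ • b 2 by module, he]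
    ring
  rw [this]
  ring

/-- The directions that belong to a pair of opposite edges, in coordinates. -/
theorem vertexHeight_signs_iff {c : Fin 4 → E3} {b : OrthonormalBasis (Fin 3) ℝ E3} {m : E3}
    (h0 : c 0 = m - (1 / 2 : ℝ) • b 0) (h1 : c 1 = m + (1 / 2 : ℝ) • b 0)
    (h2 : c 2 = m + (√2)⁻¹ • b 2 - (1 / 2 : ℝ) • b 1)
    (h3 : c 3 = m + (√2)⁻¹ • b 2 + (1 / 2 : ℝ) • b 1) (u : E3) :
    (vertexHeight c u 0 < 0 ∧ vertexHeight c u 1 < 0 ∧ 0 < vertexHeight c u 2 ∧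
      0 < vertexHeight c u 3) ↔
    √2 * |b.repr u 0| < b.repr u 2 ∧ √2 * |b.repr u 1| < b.repr u 2 := by
  have hr : ∀ t, inner ℝ u (b t) = b.repr u t := by
    intro t
    rw [b.repr_apply_apply, real_inner_comm]
  simp only [vertexHeight, Fin.sum_univ_four, h0, h1, h2, h3, inner_add_right, inner_sub_right,
    inner_smul_right, hr]
  generalize b.repr u 0 = x
  generalize b.repr u 1 = y
  generalize b.repr u 2 = z
  generalize inner ℝ u m = w
  have hs : (0 : ℝ) < √2 := by positivity
  have e : ∀ t : ℝ, √2 * |t| < z ↔ -((√2)⁻¹ * z) < t ∧ t < (√2)⁻¹ * z := by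
    intro t
    rw [← abs_lt, ← lt_div_iff₀' hs, div_eq_inv_mul]
  rw [e, e]
  constructor
  · rintro ⟨a1, a2, a3, a4⟩
    refine ⟨⟨?_, ?_⟩, ?_, ?_⟩ <;> linarith
  · rintro ⟨⟨a1, a2⟩, a3, a4⟩
    refine ⟨?_, ?_, ?_, ?_⟩ <;> linarith

/-! ### Integration of the excess width over the square -/

theorem continuous_supportProfile : Continuous supportProfile := by
  refine Continuous.if_le (by fun_prop) (by fun_prop) continuous_id continuous_const ?_
  rintro x rfl
  rw [show (1 : ℝ) - (1 / 2) ^ 2 = 3 / 4 by norm_num, Real.sqrt_div (by norm_num),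
    show √4 = (2 : ℝ) by rw [show (4 : ℝ) = 2 ^ 2 by norm_num]; exact Real.sqrt_sq (by norm_num)]
  rw [div_mul_div_comm, Real.mul_self_sqrt (by norm_num)]
  norm_num

theorem integral_sqrt_one_sub_sq_half :
    ∫ x in (0 : ℝ)..(1 / 2), √(1 - x ^ 2) = Real.pi / 12 + √3 / 8 := by
  have h : ∀ x ∈ uIcc (0 : ℝ) (1 / 2), HasDerivAt
      (fun x : ℝ => (Real.arcsin x + x * √(1 - x ^ 2)) / 2) (√(1 - x ^ 2)) x := by
    intro x hx
    rw [uIcc_of_le (by norm_num)] at hx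
    have hpos : 0 < 1 - x ^ 2 := by nlinarith [hx.1, hx.2]
    have hs := Real.sqrt_pos.2 hpos
    have hss := Real.sq_sqrt hpos.le
    have h1 := Real.hasDerivAt_arcsin (x := x) (by linarith [hx.1]) (by linarith [hx.2])
    have h2 : HasDerivAt (fun x : ℝ => 1 - x ^ 2) (-(2 * x)) x := by
      simpa using ((hasDerivAt_id x).pow 2).const_sub 1
    have h3 := (h1.add ((hasDerivAt_id x).mul (h2.sqrt hpos.ne'))).div_const 2
    refine h3.congr_deriv ?_
    simp only [id, one_mul]
    generalize √(1 - x ^ 2) = r at *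
    field_simp
    linear_combination -hss
  rw [intervalIntegral.integral_eq_sub_of_hasDerivAt h (by
    apply Continuous.intervalIntegrable; fun_prop)]
  rw [show (1 : ℝ) - (1 / 2) ^ 2 = 3 / 4 by norm_num, Real.sqrt_div (by norm_num),
    show √4 = (2 : ℝ) by rw [show (4 : ℝ) = 2 ^ 2 by norm_num]; exact Real.sqrt_sq (by norm_num)]
  have : Real.arcsin (1 / 2) = Real.pi / 6 := by
    rw [← Real.sin_pi_div_six]
    exact Real.arcsin_sin (by linarith [Real.pi_pos]) (by linarith [Real.pi_pos])
  rw [this]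
  simp
  ring

theorem integral_supportProfile {S : ℝ} (hS : 1 / 2 ≤ S) :
    ∫ x in (0 : ℝ)..S, (2 * supportProfile |x| - 1) =
      √3 * Real.pi / 12 - 1 / 2 + S - S ^ 2 / 2 := by
  have hc : Continuous fun x : ℝ => 2 * supportProfile |x| - 1 :=
    (continuous_const.mul (continuous_supportProfile.comp continuous_abs)).sub continuous_const
  rw [← intervalIntegral.integral_add_adjacent_intervals (b := 1 / 2) (hc.intervalIntegrable _ _)
    (hc.intervalIntegrable _ _)]
  have h1 : ∫ x in (0 : ℝ)..(1 / 2), (2 * supportProfile |x| - 1)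
      = ∫ x in (0 : ℝ)..(1 / 2), (√3 * √(1 - x ^ 2) - 1) := by
    refine intervalIntegral.integral_congr fun x hx => ?_
    rw [uIcc_of_le (by norm_num)] at hx
    rw [abs_of_nonneg hx.1, supportProfile, if_pos hx.2]
    ring
  have h2 : ∫ x in (1 / 2 : ℝ)..S, (2 * supportProfile |x| - 1)
      = ∫ x in (1 / 2 : ℝ)..S, (1 - x) := by
    refine intervalIntegral.integral_congr fun x hx => ?_
    rw [uIcc_of_le hS] at hx
    rw [abs_of_nonneg (by linarith [hx.1]), supportProfile]
    split_ifs with h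
    · obtain rfl : x = 1 / 2 := le_antisymm h hx.1
      rw [show (1 : ℝ) - (1 / 2) ^ 2 = 3 / 4 by norm_num, Real.sqrt_div (by norm_num),
        show √4 = (2 : ℝ) by
          rw [show (4 : ℝ) = 2 ^ 2 by norm_num]; exact Real.sqrt_sq (by norm_num)]
      rw [div_mul_div_comm, Real.mul_self_sqrt (by norm_num)]
      norm_num
    · ring
  rw [h1, h2, intervalIntegral.integral_sub (by apply Continuous.intervalIntegrable; fun_prop)
    (by simp), intervalIntegral.integral_const_mul, integral_sqrt_one_sub_sq_half,
    intervalIntegral.integral_sub (by simp) (by apply Continuous.intervalIntegrable; fun_prop)]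
  have h3 : √3 * √3 = 3 := Real.mul_self_sqrt (by norm_num)
  simp
  linear_combination h3 / 8

/-- The integrand on the plane of the central projection whose symmetrization gives the excess of
the width over one. -/
noncomputable def halfDensity (p : ℝ × ℝ) : ℝ :=
  (2 * supportProfile (|p.2| / √(1 + p.1 ^ 2 + p.2 ^ 2)) - 1) / √(1 + p.1 ^ 2 + p.2 ^ 2) ^ 3
    - (√2)⁻¹ * (1 / √(1 + p.1 ^ 2 + p.2 ^ 2) ^ 2
      - 2 * p.2 ^ 2 / √(1 + p.1 ^ 2 + p.2 ^ 2) ^ 4)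

/-- The excess of the width over one in the direction of `(p.1, p.2, 1)`, times the density of the
area of the sphere in the central projection. -/
noncomputable def widthDensity (p : ℝ × ℝ) : ℝ :=
  (supportProfile (|p.1| / √(1 + p.1 ^ 2 + p.2 ^ 2)) +
    supportProfile (|p.2| / √(1 + p.1 ^ 2 + p.2 ^ 2))
    - (√2)⁻¹ / √(1 + p.1 ^ 2 + p.2 ^ 2) - 1) / √(1 + p.1 ^ 2 + p.2 ^ 2) ^ 3

theorem one_add_sq_add_sq_pos (x y : ℝ) : 0 < √(1 + x ^ 2 + y ^ 2) := by positivity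

theorem continuous_halfDensity : Continuous halfDensity := by
  have h0 : ∀ p : ℝ × ℝ, √(1 + p.1 ^ 2 + p.2 ^ 2) ≠ 0 :=
    fun p => (one_add_sq_add_sq_pos p.1 p.2).ne'
  have h1 : Continuous fun p : ℝ × ℝ => supportProfile (|p.2| / √(1 + p.1 ^ 2 + p.2 ^ 2)) :=
    continuous_supportProfile.comp (by fun_prop (disch := exact h0 _))
  unfold halfDensity
  fun_prop (disch := intro p; exact pow_ne_zero _ (h0 p))

/-- With `N ^ 2 = 1 + x ^ 2 + y ^ 2`, the terms `1 / N ^ 2 - 2 * x ^ 2 / N ^ 4` and `1 / N ^ 2 - 2 *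
y ^ 2 / N ^ 4` average to `1 / N ^ 4`. Each is an exact derivative, of `x / N ^ 2` or `y / N ^ 2`,
which is why `halfDensity` is easier to integrate. -/
theorem widthDensity_eq (p : ℝ × ℝ) :
    widthDensity p = (halfDensity p + halfDensity p.swap) / 2 := by
  have h0 := one_add_sq_add_sq_pos p.1 p.2
  have h1 : √(1 + p.1 ^ 2 + p.2 ^ 2) ^ 2 = 1 + p.1 ^ 2 + p.2 ^ 2 := Real.sq_sqrt (by positivity)
  simp only [widthDensity, halfDensity, Prod.fst_swap, Prod.snd_swap]
  rw [add_right_comm 1 (p.2 ^ 2) (p.1 ^ 2)]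
  generalize √(1 + p.1 ^ 2 + p.2 ^ 2) = N at *
  have : 1 / N ^ 2 - (p.1 ^ 2 + p.2 ^ 2) / N ^ 4 = 1 / N ^ 4 := by
    field_simp
    linear_combination h1
  linear_combination (√2)⁻¹ * this

theorem continuous_widthDensity : Continuous widthDensity := by
  have h : widthDensity = fun p => (halfDensity p + halfDensity p.swap) / 2 :=
    funext widthDensity_eq
  rw [h]
  exact (continuous_halfDensity.add (continuous_halfDensity.comp continuous_swap)).div_const 2

/-- For fixed `y`, the derivative of `x / N` in `x` is `(1 + y ^ 2) / N ^ 3`. So the profile term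
integrates to `Φ (x / N) / (1 + y ^ 2)`, with `Φ` a primitive of the profile. At the end of the line
`x / N = 1 / √(3 + 2 * y ^ 2) ≥ 1 / 2`, so `integral_supportProfile` applies. -/
theorem integral_halfDensity_line (y : ℝ) (hy : |y| ≤ (√2)⁻¹) :
    ∫ x in (-(√2)⁻¹)..(√2)⁻¹, halfDensity (y, x) =
      2 * ((√3 * Real.pi / 12 - 1 + 1 / √(3 + 2 * y ^ 2)) / (1 + y ^ 2)) := by
  have hs0 : 0 < (√2)⁻¹ := by positivity
  have hss : (√2)⁻¹ ^ 2 = (1 / 2 : ℝ) := by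
    rw [inv_pow, Real.sq_sqrt (by norm_num)]; norm_num
  have hy2 : y ^ 2 ≤ 1 / 2 := by
    rw [← hss, ← sq_abs]; gcongr
  obtain ⟨Φ, hΦ⟩ : ∃ Φ : ℝ → ℝ, Φ = fun t => ∫ x in (0 : ℝ)..t, (2 * supportProfile |x| - 1) :=
    ⟨_, rfl⟩
  have hcont : Continuous fun x : ℝ => 2 * supportProfile |x| - 1 :=
    (continuous_const.mul (continuous_supportProfile.comp continuous_abs)).sub continuous_const
  have hΦd : ∀ t, HasDerivAt Φ (2 * supportProfile |t| - 1) t := by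
    intro t
    rw [hΦ]
    exact (hcont.integral_hasStrictDerivAt 0 t).hasDerivAt
  have hΦodd : ∀ t, Φ (-t) = - Φ t := by
    intro t
    have := intervalIntegral.integral_comp_neg (a := 0) (b := t)
      (fun x : ℝ => 2 * supportProfile |x| - 1)
    simp only [abs_neg, neg_zero] at this
    simp only [hΦ]
    rw [this, intervalIntegral.integral_symm]
  have hd : ∀ x ∈ uIcc (-(√2)⁻¹) (√2)⁻¹, HasDerivAt (fun x : ℝ =>
      Φ (x / √(1 + y ^ 2 + x ^ 2)) / (1 + y ^ 2) - (√2)⁻¹ * (x / (1 + y ^ 2 + x ^ 2)))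
      (halfDensity (y, x)) x := by
    intro x _
    have hpos : 0 < 1 + y ^ 2 + x ^ 2 := by positivity
    have hN := one_add_sq_add_sq_pos y x
    have hNN := Real.sq_sqrt hpos.le
    have h1 : HasDerivAt (fun x : ℝ => 1 + y ^ 2 + x ^ 2) (2 * x) x := by
      simpa using ((hasDerivAt_id x).pow 2).const_add (1 + y ^ 2)
    have h2 := (hasDerivAt_id x).div (h1.sqrt hpos.ne') hN.ne'
    have h3 := ((hΦd (x / √(1 + y ^ 2 + x ^ 2))).comp x h2).div_const (1 + y ^ 2)
    have h4 := ((hasDerivAt_id x).div h1 hpos.ne').const_mul (√2)⁻¹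
    refine (h3.sub h4).congr_deriv ?_
    simp only [halfDensity, id, abs_div, abs_of_pos hN]
    generalize supportProfile _ = w
    rw [← hNN]
    have hpos' : 0 < 1 + y ^ 2 := by positivity
    have hB : 1 + y ^ 2 = √(1 + y ^ 2 + x ^ 2) ^ 2 - x ^ 2 := by rw [hNN]; ring
    generalize √(1 + y ^ 2 + x ^ 2) = N at *
    rw [hB] at hpos' ⊢
    have := hpos'.ne'
    rw [Real.sqrt_sq hN.le]
    field_simp
  rw [intervalIntegral.integral_eq_sub_of_hasDerivAt hd (by
    apply Continuous.intervalIntegrable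
    exact continuous_halfDensity.comp (by fun_prop))]
  rw [neg_sq, neg_div, hΦodd, hss]
  have hB : (0 : ℝ) < 1 + y ^ 2 := by positivity
  have h32 : (0 : ℝ) < 3 + 2 * y ^ 2 := by positivity
  have hS : (√2)⁻¹ / √(1 + y ^ 2 + 1 / 2) = 1 / √(3 + 2 * y ^ 2) := by
    rw [← one_div, div_div, ← Real.sqrt_mul (by norm_num)]
    congr 2
    ring
  have hS1 : 1 / 2 ≤ 1 / √(3 + 2 * y ^ 2) := by
    apply one_div_le_one_div_of_le (by positivity)
    rw [Real.sqrt_le_left (by norm_num)]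
    linarith
  have hSS : (1 / √(3 + 2 * y ^ 2)) ^ 2 = 1 / (3 + 2 * y ^ 2) := by
    rw [div_pow, Real.sq_sqrt h32.le, one_pow]
  have hΦS : Φ (1 / √(3 + 2 * y ^ 2)) = √3 * Real.pi / 12 - 1 / 2 + 1 / √(3 + 2 * y ^ 2)
      - (1 / √(3 + 2 * y ^ 2)) ^ 2 / 2 := by
    rw [hΦ]
    exact integral_supportProfile hS1
  rw [hS, hΦS, hSS]
  have e : (√2)⁻¹ * (√2)⁻¹ = (1 / 2 : ℝ) := by rw [← hss]; ring
  generalize 1 / √(3 + 2 * y ^ 2) = S at *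
  have e2 : (√2)⁻¹ * ((√2)⁻¹ / (1 + y ^ 2 + 1 / 2)) = 1 / (3 + 2 * y ^ 2) := by
    rw [← mul_div_assoc, e]
    have : 1 + y ^ 2 + 1 / 2 ≠ 0 := by positivity
    field_simp
    ring
  have e3 : (√2)⁻¹ * (-(√2)⁻¹ / (1 + y ^ 2 + 1 / 2)) = - (1 / (3 + 2 * y ^ 2)) := by
    rw [← e2]; ring
  rw [e2, e3]
  field_simp
  ring

theorem arctan_inv_sqrt_two : Real.arctan (√2)⁻¹ = Real.arccos (1 / 3) / 2 := by
  have hss : (√2)⁻¹ ^ 2 = (1 / 2 : ℝ) := by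
    rw [inv_pow, Real.sq_sqrt (by norm_num)]; norm_num
  have h1 : (√2)⁻¹ < 1 := by
    have : 0 < (√2)⁻¹ := by positivity
    nlinarith
  have h2 : 2 * √2⁻¹ / (1 - 1 / 2) = √(1 - (1 / 3) ^ 2) / (1 / 3) := by
    have : (1 : ℝ) - (1 / 3) ^ 2 = (2 / 3) ^ 2 * 2 := by norm_num
    rw [this, Real.sqrt_mul (by positivity), Real.sqrt_sq (by positivity), Real.sqrt_inv]
    field_simp
    rw [Real.sq_sqrt (by norm_num)]
    norm_num
  rw [Real.arccos_eq_arctan (by norm_num), ← h2, eq_div_iff two_ne_zero, mul_comm,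
    Real.two_mul_arctan (by linarith [show 0 < (√2)⁻¹ by positivity]) h1, hss, Real.sqrt_inv]

theorem arctan_inv_sqrt_two_half :
    Real.arctan ((√2)⁻¹ / 2) = Real.pi / 2 - Real.arccos (1 / 3) := by
  have h2 : √(1 - (1 / 3) ^ 2) / (1 / 3) = 2 * √2 := by
    have : (1 : ℝ) - (1 / 3) ^ 2 = (2 / 3) ^ 2 * 2 := by norm_num
    rw [this, Real.sqrt_mul (by positivity), Real.sqrt_sq (by positivity)]
    ring
  rw [Real.arccos_eq_arctan (by norm_num), h2, ← Real.arctan_inv_of_pos (by positivity), mul_inv]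
  congr 1
  ring

theorem integral_halfDensity :
    ∫ p in Ioo (-(√2)⁻¹) (√2)⁻¹ ×ˢ Ioo (-(√2)⁻¹) (√2)⁻¹, halfDensity p =
      2 * Real.pi - 6 * Real.arccos (1 / 3) + √3 * Real.pi * Real.arccos (1 / 3) / 6 := by
  have hs0 : 0 < (√2)⁻¹ := by positivity
  have hle : -(√2)⁻¹ ≤ (√2)⁻¹ := by linarith
  have hint : IntegrableOn halfDensity (Ioo (-(√2)⁻¹) (√2)⁻¹ ×ˢ Ioo (-(√2)⁻¹) (√2)⁻¹) :=
    (continuous_halfDensity.continuousOn.integrableOn_compact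
      (isCompact_Icc.prod isCompact_Icc)).mono_set
      (prod_mono Ioo_subset_Icc_self Ioo_subset_Icc_self)
  rw [Measure.volume_eq_prod, setIntegral_prod _ hint, ← integral_Ioc_eq_integral_Ioo,
    ← intervalIntegral.integral_of_le hle]
  have h1 : ∀ y ∈ uIcc (-(√2)⁻¹) (√2)⁻¹, ∫ x in Ioo (-(√2)⁻¹) (√2)⁻¹, halfDensity (y, x) =
      2 * ((√3 * Real.pi / 12 - 1 + 1 / √(3 + 2 * y ^ 2)) / (1 + y ^ 2)) := by
    intro y hy
    rw [uIcc_of_le hle] at hy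
    rw [← integral_halfDensity_line y (abs_le.2 hy), intervalIntegral.integral_of_le hle,
      integral_Ioc_eq_integral_Ioo]
  rw [intervalIntegral.integral_congr h1]
  -- The arctangent of `y / √(3 + 2 * y ^ 2)` has derivative `1 / ((1 + y ^ 2) * √(3 + 2 * y ^ 2))`.
  have hd : ∀ y ∈ uIcc (-(√2)⁻¹) (√2)⁻¹, HasDerivAt (fun y : ℝ =>
      2 * ((√3 * Real.pi / 12 - 1) * Real.arctan y + Real.arctan (y / √(3 + 2 * y ^ 2))))
      (2 * ((√3 * Real.pi / 12 - 1 + 1 / √(3 + 2 * y ^ 2)) / (1 + y ^ 2))) y := by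
    intro y _
    have hpos : 0 < 3 + 2 * y ^ 2 := by positivity
    have hN : 0 < √(3 + 2 * y ^ 2) := Real.sqrt_pos.2 hpos
    have hNN := Real.sq_sqrt hpos.le
    have h1 : HasDerivAt (fun x : ℝ => 3 + 2 * x ^ 2) (2 * (2 * y)) y := by
      simpa using (((hasDerivAt_id y).pow 2).const_mul 2).const_add 3
    have h2 := ((hasDerivAt_id y).div (h1.sqrt hpos.ne') hN.ne').arctan
    refine ((((Real.hasDerivAt_arctan y).const_mul
      (√3 * Real.pi / 12 - 1)).add h2).const_mul 2).congr_deriv ?_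
    simp only [id, Pi.div_apply]
    generalize √(3 + 2 * y ^ 2) = N at *
    have hB : 0 < 1 + y ^ 2 := by positivity
    have hC : 1 + (y / N) ^ 2 = 3 * (1 + y ^ 2) / N ^ 2 := by
      field_simp
      linear_combination hNN
    have hD : (1 * N - y * (2 * (2 * y) / (2 * N))) / N ^ 2 = 3 / N ^ 3 := by
      field_simp
      linear_combination hNN
    rw [hC, hD]
    field_simp
  rw [intervalIntegral.integral_eq_sub_of_hasDerivAt hd (by
    apply Continuous.intervalIntegrable
    have h0 : ∀ y : ℝ, √(3 + 2 * y ^ 2) ≠ 0 := fun y => by positivity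
    have h0' : ∀ y : ℝ, 1 + y ^ 2 ≠ 0 := fun y => by positivity
    fun_prop (disch := first | exact h0 | exact h0'))]
  have hss : (√2)⁻¹ ^ 2 = (1 / 2 : ℝ) := by
    rw [inv_pow, Real.sq_sqrt (by norm_num)]; norm_num
  have h4 : √(3 + 2 * (1 / 2)) = (2 : ℝ) := by
    rw [show (3 : ℝ) + 2 * (1 / 2) = 2 ^ 2 by norm_num]; exact Real.sqrt_sq (by norm_num)
  rw [neg_sq, neg_div, Real.arctan_neg, Real.arctan_neg, hss, h4, arctan_inv_sqrt_two,
    arctan_inv_sqrt_two_half]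
  ring

theorem integral_widthDensity :
    ∫ p in Ioo (-(√2)⁻¹) (√2)⁻¹ ×ˢ Ioo (-(√2)⁻¹) (√2)⁻¹, widthDensity p =
      2 * Real.pi - 6 * Real.arccos (1 / 3) + √3 * Real.pi * Real.arccos (1 / 3) / 6 := by
  have hint : ∀ f : ℝ × ℝ → ℝ, Continuous f →
      IntegrableOn f (Ioo (-(√2)⁻¹) (√2)⁻¹ ×ˢ Ioo (-(√2)⁻¹) (√2)⁻¹) := fun f hf =>
    (hf.continuousOn.integrableOn_compact (isCompact_Icc.prod isCompact_Icc)).mono_set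
      (prod_mono Ioo_subset_Icc_self Ioo_subset_Icc_self)
  simp_rw [widthDensity_eq]
  rw [integral_div, integral_add (hint _ continuous_halfDensity)
    (hint (fun p => halfDensity p.swap) (continuous_halfDensity.comp continuous_swap)),
    integral_halfDensity]
  have := setIntegral_prod_swap (μ := (volume : Measure ℝ)) (ν := (volume : Measure ℝ))
    (Ioo (-(√2)⁻¹) (√2)⁻¹) (Ioo (-(√2)⁻¹) (√2)⁻¹) halfDensity
  rw [← Measure.volume_eq_prod] at this
  rw [this, integral_halfDensity]
  ring

/-! ### Inequalities for the width on the edge regions -/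

theorem one_le_supportProfile_add {x y z : ℝ} (hx : 0 ≤ x) (hy : 0 ≤ y) (h : x ^ 2 + y ^ 2 + z ^ 2 = 1)
    (hxz : √2 * x ≤ z) (hyz : √2 * y ≤ z) :
    1 ≤ supportProfile x + supportProfile y - (√2)⁻¹ * z := by
  have h2 : √2 * √2 = 2 := Real.mul_self_sqrt (by norm_num)
  have h20 : 0 < √2 := by positivity
  have hz : 0 ≤ z := le_trans (by positivity) hxz
  have hx2 : 2 * x ^ 2 ≤ z ^ 2 := by
    have := mul_self_le_mul_self (by positivity) hxz
    nlinarith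
  have hy2 : 2 * y ^ 2 ≤ z ^ 2 := by
    have := mul_self_le_mul_self (by positivity) hyz
    nlinarith
  have hss : (√2)⁻¹ ^ 2 = (1 / 2 : ℝ) := by
    rw [inv_pow, Real.sq_sqrt (by norm_num)]; norm_num
  have hs0 : 0 < (√2)⁻¹ := by positivity
  generalize (√2)⁻¹ = s at *
  have hr : √3 ^ 2 = 3 := Real.sq_sqrt (by norm_num)
  have hr0 : 0 < √3 := by positivity
  -- One contact on a face, the other on an edge: Cauchy–Schwarz for `(x, z)` and `(1 / 2, s)`, the
  -- latter of squared length `3 / 4`.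
  have large : ∀ x y : ℝ, 0 ≤ x → 0 ≤ y → x ^ 2 + y ^ 2 + z ^ 2 = 1 → 2 * x ^ 2 ≤ z ^ 2 →
      1 / 2 < x → 1 ≤ supportProfile x + supportProfile y - s * z := by
    intro x y hx hy h hx2 hxl
    have hyl : y ≤ 1 / 2 := by nlinarith
    rw [supportProfile, supportProfile, if_neg (not_le.2 hxl), if_pos hyl]
    have : x / 2 + s * z ≤ √3 / 2 * √(1 - y ^ 2) := by
      rw [show √3 / 2 * √(1 - y ^ 2) = √(3 / 4 * (x ^ 2 + z ^ 2)) by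
        rw [Real.sqrt_mul (by norm_num), Real.sqrt_div (by norm_num),
          show √4 = (2 : ℝ) by
            rw [show (4 : ℝ) = 2 ^ 2 by norm_num]; exact Real.sqrt_sq (by norm_num)]
        congr 2
        linarith]
      apply Real.le_sqrt_of_sq_le
      nlinarith [sq_nonneg (s * x - z / 2)]
    linarith
  by_cases hxl : x ≤ 1 / 2
  · by_cases hyl : y ≤ 1 / 2
    · rw [supportProfile, supportProfile, if_pos hxl, if_pos hyl]
      have hxl2 : x ^ 2 ≤ 1 / 4 := by nlinarith
      have hyl2 : y ^ 2 ≤ 1 / 4 := by nlinarith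
      have hA := Real.sq_sqrt (show 0 ≤ 1 - x ^ 2 by linarith)
      have hB := Real.sq_sqrt (show 0 ≤ 1 - y ^ 2 by linarith)
      have hA0 := Real.sqrt_nonneg (1 - x ^ 2)
      have hB0 := Real.sqrt_nonneg (1 - y ^ 2)
      generalize √(1 - x ^ 2) = A at *
      generalize √(1 - y ^ 2) = B at *
      -- For fixed `z` and both coordinates at most `1 / 2`, the sum `A + B` is smallest when one
      -- coordinate equals `1 / 2`; the roots are then `√3 / 2` and `C`.
      have hC := Real.sq_sqrt (show 0 ≤ z ^ 2 + 1 / 4 by positivity)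
      have hC0 := Real.sqrt_nonneg (z ^ 2 + 1 / 4)
      generalize √(z ^ 2 + 1 / 4) = C at *
      have h1 : √3 / 2 * C ≤ A * B := by
        rw [← sq_le_sq₀ (by positivity) (by positivity), mul_pow, mul_pow, div_pow, hr, hA, hB, hC]
        nlinarith [mul_nonneg (sub_nonneg.2 hxl2) (sub_nonneg.2 hyl2)]
      have h2 : √3 / 2 + C ≤ A + B := by
        rw [← sq_le_sq₀ (by positivity) (by positivity)]
        nlinarith
      have h3 : 1 / 4 + s * z ≤ √3 / 2 * C := by
        rw [← sq_le_sq₀ (by positivity) (by positivity), mul_pow, div_pow, hr, hC]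
        nlinarith [sq_nonneg (z / 2 - s / 2)]
      nlinarith
    · have := large y x hy hx (by linarith) hy2 (not_le.1 hyl)
      linarith
  · exact large x y hx hy h hx2 (not_le.1 hxl)

theorem supportProfile_le {x : ℝ} (hx : 0 ≤ x) (hx2 : x ^ 2 ≤ 1 / 3) :
    supportProfile x ≤ √3 / 2 * (1 - x ^ 2 / 2) := by
  have hr : √3 ^ 2 = 3 := Real.sq_sqrt (by norm_num)
  have hr0 : 0 < √3 := by positivity
  rw [supportProfile]
  split_ifs with h
  · gcongr
    rw [Real.sqrt_le_left (by linarith)]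
    nlinarith [sq_nonneg (x ^ 2)]
  · push Not at h
    have hr1 : 1.732 ≤ √3 := Real.le_sqrt_of_sq_le (by norm_num)
    have hx3 : x ≤ 0.578 := by nlinarith
    nlinarith [mul_nonneg (sub_nonneg.2 h.le) (sub_nonneg.2 hx3)]

/-- The quadratic bound `supportProfile_le` leaves `(√2)⁻¹ * (1 - z) ≤ √3 / 4 * (1 - z ^ 2)`. After
division by `1 - z` this holds because `z ≥ 0.7`. -/
theorem supportProfile_add_le {x y z : ℝ} (hx : 0 ≤ x) (hy : 0 ≤ y) (h : x ^ 2 + y ^ 2 + z ^ 2 = 1)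
    (hxz : √2 * x ≤ z) (hyz : √2 * y ≤ z) :
    supportProfile x + supportProfile y - (√2)⁻¹ * z ≤ √3 - (√2)⁻¹ := by
  have h2 : √2 * √2 = 2 := Real.mul_self_sqrt (by norm_num)
  have hz : 0 ≤ z := le_trans (by positivity) hxz
  have hx2 : 2 * x ^ 2 ≤ z ^ 2 := by
    have := mul_self_le_mul_self (by positivity) hxz
    nlinarith
  have hy2 : 2 * y ^ 2 ≤ z ^ 2 := by
    have := mul_self_le_mul_self (by positivity) hyz
    nlinarith
  have h1 := supportProfile_le hx (by nlinarith)
  have h3 := supportProfile_le hy (by nlinarith)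
  have hr1 : 1.732 ≤ √3 := Real.le_sqrt_of_sq_le (by norm_num)
  have hs : (√2)⁻¹ ≤ 0.71 := by
    rw [inv_le_comm₀ (by positivity) (by norm_num)]
    apply Real.le_sqrt_of_sq_le
    norm_num
  have hz1 : 0.7 ≤ z := by nlinarith
  have hz2 : z ≤ 1 := by nlinarith
  nlinarith [mul_nonneg (sub_nonneg.2 hz2) (sub_nonneg.2 hz1),
    mul_nonneg (sub_nonneg.2 hz2) (sub_nonneg.2 hs),
    mul_nonneg (mul_nonneg (sub_nonneg.2 hz2) (sub_nonneg.2 hr1)) (show 0 ≤ 1 + z by linarith)]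

/-! ### Counting the edge regions; extreme widths -/

/-- The direction `u` belongs to a pair of opposite edges of the tetrahedron `c`. -/
def IsEdgeDirection (c : Fin 4 → E3) (u : E3) : Prop :=
  vertexHeight c u 0 < 0 ∧ vertexHeight c u 1 < 0 ∧ 0 < vertexHeight c u 2 ∧ 0 < vertexHeight c u 3

/-- The hypotheses force exactly two of each sign, leaving `2! * 2!` arrangements. -/
theorem card_perm_signs (s : Fin 4 → Bool) (h : ∀ k, ∃ j, j ≠ k ∧ s j = true)
    (h' : ∀ k, ∃ j, j ≠ k ∧ s j = false) :
    (Finset.univ.filter fun σ : Equiv.Perm (Fin 4) =>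
      s (σ 0) = true ∧ s (σ 1) = true ∧ s (σ 2) = false ∧ s (σ 3) = false).card = 4 := by
  revert s
  decide

open Classical in
theorem width_eq_one_or_card {c : Fin 4 → E3} (hc : ∀ i j, i ≠ j → dist (c i) (c j) = 1)
    {u : E3} (hu : ‖u‖ = 1) : width (ballIntersection c) u = 1 ∨
    (Finset.univ.filter fun σ : Equiv.Perm (Fin 4) => IsEdgeDirection (c ∘ σ) u).card = 4 := by
  by_cases h1 : ∃ k, ∀ j, j ≠ k → 0 ≤ vertexHeight c u j
  · obtain ⟨k, hk⟩ := h1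
    exact .inl (width_eq_one_of_nonneg hc hu k hk)
  by_cases h2 : ∃ k, ∀ j, j ≠ k → vertexHeight c u j ≤ 0
  · obtain ⟨k, hk⟩ := h2
    exact .inl (width_eq_one_of_nonpos hc hu k hk)
  right
  push Not at h1 h2
  -- There are two negative and two positive heights; a vanishing one would need a fifth vertex.
  have hne : ∀ j, vertexHeight c u j ≠ 0 := by
    intro j hj
    obtain ⟨i₁, hi₁, hi₁'⟩ := h1 j
    obtain ⟨i₂, hi₂, hi₂'⟩ := h1 i₁
    obtain ⟨i₃, hi₃, hi₃'⟩ := h2 j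
    obtain ⟨i₄, hi₄, hi₄'⟩ := h2 i₃
    have a1 : i₂ ≠ j := by rintro rfl; linarith
    have a2 : i₄ ≠ j := by rintro rfl; linarith
    have a3 : i₁ ≠ i₃ := by rintro rfl; linarith
    have a4 : i₁ ≠ i₄ := by rintro rfl; linarith
    have a5 : i₂ ≠ i₃ := by rintro rfl; linarith
    have a6 : i₂ ≠ i₄ := by rintro rfl; linarith
    omega
  refine Eq.trans ?_ (card_perm_signs (fun j => decide (vertexHeight c u j < 0))
    (fun k => by simpa using h1 k)
    (fun k => by
      obtain ⟨j, hj, hj'⟩ := h2 k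
      exact ⟨j, hj, by simpa using hj'.le⟩))
  congr 1
  ext σ
  have hlt : ∀ j, 0 < vertexHeight c u j ↔ ¬ vertexHeight c u j < 0 := fun j =>
    ⟨fun h => h.le.not_gt, fun h => lt_of_le_of_ne (not_lt.1 h) (hne j).symm⟩
  simp only [Finset.mem_filter, Finset.mem_univ, true_and, IsEdgeDirection,
    vertexHeight_comp_perm, hlt, decide_eq_true_eq, decide_eq_false_iff_not]

theorem fin_four_cases (t : Fin 4) : t = 0 ∨ t = 1 ∨ t = 2 ∨ t = 3 := by
  revert t; decide

theorem sum_sq_repr (b : OrthonormalBasis (Fin 3) ℝ E3) {u : E3} (hu : ‖u‖ = 1) :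
    b.repr u 0 ^ 2 + b.repr u 1 ^ 2 + b.repr u 2 ^ 2 = 1 := by
  have h := EuclideanSpace.real_norm_sq_eq (b.repr u)
  rw [b.repr.norm_map, hu, Fin.sum_univ_three] at h
  linarith

theorem width_bounds_of_isEdgeDirection {c : Fin 4 → E3}
    (hc : ∀ i j, i ≠ j → dist (c i) (c j) = 1) {u : E3} (hu : ‖u‖ = 1)
    (h : IsEdgeDirection c u) : 1 ≤ width (ballIntersection c) u ∧
      width (ballIntersection c) u ≤ √3 - (√2)⁻¹ := by
  obtain ⟨b, m, h0, h1, h2, h3⟩ := exists_frame hc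
  obtain ⟨ha, hb⟩ := (vertexHeight_signs_iff h0 h1 h2 h3 u).1 h
  rw [width_eq_supportProfile hc fin_four_cases h0 h1 h2 h3 hu ha.le hb.le]
  have hsq := sum_sq_repr b hu
  rw [← sq_abs (b.repr u 0), ← sq_abs (b.repr u 1)] at hsq
  exact ⟨one_le_supportProfile_add (abs_nonneg _) (abs_nonneg _) hsq ha.le hb.le,
    supportProfile_add_le (abs_nonneg _) (abs_nonneg _) hsq ha.le hb.le⟩

theorem one_le_sqrt_three_sub : 1 ≤ √3 - (√2)⁻¹ := by
  have hr1 : 1.732 ≤ √3 := Real.le_sqrt_of_sq_le (by norm_num)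
  have hs : (√2)⁻¹ ≤ 0.71 := by
    rw [inv_le_comm₀ (by positivity) (by norm_num)]
    apply Real.le_sqrt_of_sq_le
    norm_num
  linarith

theorem dist_comp_perm {c : Fin 4 → E3} (hc : ∀ i j, i ≠ j → dist (c i) (c j) = 1)
    (σ : Equiv.Perm (Fin 4)) (i j : Fin 4) (hij : i ≠ j) : dist ((c ∘ σ) i) ((c ∘ σ) j) = 1 :=
  hc _ _ (σ.injective.ne hij)

theorem width_bounds {c : Fin 4 → E3} (hc : ∀ i j, i ≠ j → dist (c i) (c j) = 1) {u : E3}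
    (hu : ‖u‖ = 1) : 1 ≤ width (ballIntersection c) u ∧
      width (ballIntersection c) u ≤ √3 - (√2)⁻¹ := by
  classical
  rcases width_eq_one_or_card hc hu with h | h
  · rw [h]
    exact ⟨le_rfl, one_le_sqrt_three_sub⟩
  · obtain ⟨σ, hσ⟩ := Finset.card_pos.1 (by rw [h]; norm_num)
    rw [← ballIntersection_comp_perm c σ]
    exact width_bounds_of_isEdgeDirection (dist_comp_perm hc σ) hu (Finset.mem_filter.1 hσ).2

theorem isLeast_width {c : Fin 4 → E3} (hc : ∀ i j, i ≠ j → dist (c i) (c j) = 1) :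
    IsLeast (width (ballIntersection c) '' sphere 0 1) 1 := by
  constructor
  · obtain ⟨b, m, h0, h1, h2, h3⟩ := exists_frame hc
    have h00 : inner ℝ (b 0) (b 0) = (1 : ℝ) := by simp
    have h01 : inner ℝ (b 0) (b 1) = (0 : ℝ) := b.orthonormal.2 (by decide)
    have h02 : inner ℝ (b 0) (b 2) = (0 : ℝ) := b.orthonormal.2 (by decide)
    -- Along the edge from `c 0` to `c 1` the heights are `-1 / 2, 1 / 2, 0, 0`.
    refine ⟨b 0, by simp, width_eq_one_of_nonneg hc (by simp) 0 fun j hj => ?_⟩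
    simp only [vertexHeight, Fin.sum_univ_four, h0, h1, h2, h3, inner_add_right, inner_sub_right,
      inner_smul_right, h00, h01, h02]
    rcases fin_four_cases j with rfl | rfl | rfl | rfl
    · exact absurd rfl hj
    all_goals
      simp only [h1, h2, h3, inner_add_right, inner_sub_right, inner_smul_right, h00, h01, h02]
      linarith
  · rintro _ ⟨u, hu, rfl⟩
    exact (width_bounds hc (by simpa using hu)).1

theorem isGreatest_width {c : Fin 4 → E3} (hc : ∀ i j, i ≠ j → dist (c i) (c j) = 1) :
    IsGreatest (width (ballIntersection c) '' sphere 0 1) (√3 - (√2)⁻¹) := by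
  constructor
  · obtain ⟨b, m, h0, h1, h2, h3⟩ := exists_frame hc
    -- The maximum is attained along the common perpendicular of two opposite edges, at `z = 1`.
    refine ⟨b 2, by simp, ?_⟩
    rw [width_eq_supportProfile hc fin_four_cases h0 h1 h2 h3 (by simp) (by simp) (by simp)]
    simp [supportProfile]
  · rintro _ ⟨u, hu, rfl⟩
    exact (width_bounds hc (by simpa using hu)).2

/-! ### The mean width -/

/-- In the central projection along the third vector, the directions that belong to a pair of
opposite edges form a square. -/
theorem width_sub_one_eq_gnomonic {c : Fin 4 → E3} (hc : ∀ i j, i ≠ j → dist (c i) (c j) = 1)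
    {b : OrthonormalBasis (Fin 3) ℝ E3} {m : E3}
    (h0 : c 0 = m - (1 / 2 : ℝ) • b 0) (h1 : c 1 = m + (1 / 2 : ℝ) • b 0)
    (h2 : c 2 = m + (√2)⁻¹ • b 2 - (1 / 2 : ℝ) • b 1)
    (h3 : c 3 = m + (√2)⁻¹ • b 2 + (1 / 2 : ℝ) • b 1) {u : E3} (hu : ‖u‖ = 1)
    [Decidable (IsEdgeDirection c u)] :
    (if IsEdgeDirection c u then width (ballIntersection c) u - 1 else 0) =
      if 0 < b.repr u 2 then (b.repr u 2)⁻¹ ^ 3 *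
        (Ioo (-(√2)⁻¹) (√2)⁻¹ ×ˢ Ioo (-(√2)⁻¹) (√2)⁻¹).indicator widthDensity
          (b.repr u 0 / b.repr u 2, b.repr u 1 / b.repr u 2) else 0 := by
  have hiff := vertexHeight_signs_iff h0 h1 h2 h3 u
  have hsq := sum_sq_repr b hu
  have hw := width_eq_supportProfile hc fin_four_cases h0 h1 h2 h3 hu
  change IsEdgeDirection c u ↔ _ at hiff
  generalize b.repr u 0 = x at *
  generalize b.repr u 1 = y at *
  generalize b.repr u 2 = z at *
  by_cases hz : 0 < z
  · have hmem : ∀ t : ℝ, √2 * |t| < z ↔ t / z ∈ Ioo (-(√2)⁻¹) (√2)⁻¹ := by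
      intro t
      rw [mem_Ioo, ← abs_lt, abs_div, abs_of_pos hz, div_lt_iff₀ hz, ← div_eq_inv_mul,
        lt_div_iff₀' (by positivity)]
    rw [if_pos hz]
    by_cases hE : IsEdgeDirection c u
    · obtain ⟨ha, hb⟩ := hiff.1 hE
      have hN : √(1 + (x / z) ^ 2 + (y / z) ^ 2) = z⁻¹ := by
        rw [← Real.sqrt_sq (inv_nonneg.2 hz.le)]
        congr 1
        field_simp
        linarith
      rw [if_pos hE, indicator_of_mem (mk_mem_prod ((hmem x).1 ha) ((hmem y).1 hb)), widthDensity,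
        hw ha.le hb.le]
      simp only
      rw [hN, abs_div, abs_div, abs_of_pos hz, div_inv_eq_mul, div_inv_eq_mul, div_inv_eq_mul,
        div_mul_cancel₀ _ hz.ne', div_mul_cancel₀ _ hz.ne', mul_div_cancel₀ _ (by positivity)]
    · rw [if_neg hE, indicator_of_notMem, mul_zero]
      rintro ⟨hx, hy⟩
      exact hE (hiff.2 ⟨(hmem x).2 hx, (hmem y).2 hy⟩)
  · rw [if_neg hz, if_neg]
    intro hE
    exact hz (lt_of_le_of_lt (by positivity) (hiff.1 hE).1)

open Classical in
theorem integral_edge_excess {c : Fin 4 → E3} (hc : ∀ i j, i ≠ j → dist (c i) (c j) = 1) :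
    Integrable (fun u : sphere (0 : E3) 1 =>
      if IsEdgeDirection c u then width (ballIntersection c) u - 1 else 0)
      (volume : Measure E3).toSphere ∧
    ∫ u : sphere (0 : E3) 1, (if IsEdgeDirection c u then width (ballIntersection c) u - 1 else 0)
      ∂(volume : Measure E3).toSphere =
      2 * Real.pi - 6 * Real.arccos (1 / 3) + √3 * Real.pi * Real.arccos (1 / 3) / 6 := by
  obtain ⟨b, m, h0, h1, h2, h3⟩ := exists_frame hc
  have hms : MeasurableSet (Ioo (-(√2)⁻¹) (√2)⁻¹ ×ˢ Ioo (-(√2)⁻¹) (√2)⁻¹) :=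
    measurableSet_Ioo.prod measurableSet_Ioo
  have hint : IntegrableOn widthDensity (Ioo (-(√2)⁻¹) (√2)⁻¹ ×ˢ Ioo (-(√2)⁻¹) (√2)⁻¹) :=
    (continuous_widthDensity.continuousOn.integrableOn_compact
      (isCompact_Icc.prod isCompact_Icc)).mono_set
      (prod_mono Ioo_subset_Icc_self Ioo_subset_Icc_self)
  have key := integral_gnomonic b ((integrable_indicator_iff hms).2 hint)
    (continuous_widthDensity.measurable.indicator hms)
  rw [integral_indicator hms, integral_widthDensity] at key
  have hcongr : ∀ u : sphere (0 : E3) 1, _ := fun u =>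
    width_sub_one_eq_gnomonic hc h0 h1 h2 h3 (u := (u : E3)) (by simp)
  simp_rw [← hcongr] at key
  exact key

theorem meanWidth_eq {c : Fin 4 → E3} (hc : ∀ i j, i ≠ j → dist (c i) (c j) = 1) :
    meanWidth (ballIntersection c) = (16 * Real.pi - (36 - √3 * Real.pi) * arcsec 3) /
      (4 * Real.pi) := by
  classical
  -- Summing over all 24 labellings of the vertices counts each direction of an edge region four
  -- times, hence the factor `1 / 4`.
  have hw : ∀ u : sphere (0 : E3) 1, width (ballIntersection c) u = 1 + 1 / 4 *
      ∑ σ : Equiv.Perm (Fin 4), if IsEdgeDirection (c ∘ σ) u then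
        width (ballIntersection (c ∘ σ)) u - 1 else 0 := by
    intro u
    simp_rw [ballIntersection_comp_perm]
    rw [← Finset.sum_filter, Finset.sum_const]
    rcases width_eq_one_or_card hc (u := (u : E3)) (by simp) with h | h
    · rw [h]; simp
    · rw [h]; simp
  have hI := fun σ : Equiv.Perm (Fin 4) => integral_edge_excess (dist_comp_perm hc σ)
  have hμ : (volume : Measure E3).toSphere.real univ = 4 * Real.pi := by
    rw [Measure.toSphere_real_apply_univ, measureReal_def, EuclideanSpace.volume_ball_fin_three]
    rw [ENNReal.toReal_mul, ENNReal.toReal_pow, ENNReal.toReal_ofReal zero_le_one,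
      ENNReal.toReal_ofReal (by positivity)]
    simp
    ring
  have hint : ∫ u : sphere (0 : E3) 1, width (ballIntersection c) u
      ∂(volume : Measure E3).toSphere = 4 * Real.pi + 1 / 4 * (24 * (2 * Real.pi -
        6 * Real.arccos (1 / 3) + √3 * Real.pi * Real.arccos (1 / 3) / 6)) := by
    simp_rw [hw]
    rw [integral_add (integrable_const _)
      ((integrable_finsetSum _ fun σ _ => (hI σ).1).const_mul _), integral_const, hμ,
      integral_const_mul, integral_finsetSum _ fun σ _ => (hI σ).1]
    simp_rw [fun σ => (hI σ).2]
    rw [Finset.sum_const, Finset.card_univ, Fintype.card_perm, Fintype.card_fin]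
    simp [Nat.factorial]
    ring
  rw [meanWidth, average_eq, hμ, hint, arcsec, smul_eq_mul]
  field_simp
  ring

/-! ### Decimal bounds -/

/-- The argument has square `1 / 8`, so after removing one factor the arctangent series is
alternating with rational terms. Consecutive partial sums of 20 and 21 terms enclose it. The
complementary angle is `arccos (1 / 3)`. -/
theorem arctan_inv_sqrt_two_half_bounds :
    0.339836909454121937 < Real.arctan ((√2)⁻¹ / 2) ∧
      Real.arctan ((√2)⁻¹ / 2) < 0.3398369094541219372 := by
  have hs0 : 0 < (√2)⁻¹ := by positivity
  have hss : (√2)⁻¹ ^ 2 = (1 / 2 : ℝ) := by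
    rw [inv_pow, Real.sq_sqrt (by norm_num)]; norm_num
  have hlo : 0.70710678118654752440 < (√2)⁻¹ := by nlinarith
  have hhi : (√2)⁻¹ < 0.70710678118654752441 := by nlinarith
  generalize (√2)⁻¹ = s at *
  have hsum := Real.hasSum_arctan (x := s / 2) (by
    rw [Real.norm_of_nonneg (by positivity)]; linarith)
  have hterm : ∀ n : ℕ, (-1 : ℝ) ^ n * (s / 2) ^ (2 * n + 1) / ((2 * n + 1 : ℕ) : ℝ)
      = s / 2 * ((-1) ^ n * ((1 / 8) ^ n / (2 * n + 1))) := by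
    intro n
    have : (s / 2) ^ (2 * n + 1) = s / 2 * (1 / 8) ^ n := by
      rw [pow_succ, pow_mul, div_pow, hss, mul_comm]
      norm_num
    rw [this]
    push_cast
    ring
  simp_rw [hterm] at hsum
  have hL := (hsum.mul_left (s / 2)⁻¹).tendsto_sum_nat
  simp_rw [inv_mul_cancel_left₀ (show s / 2 ≠ 0 by positivity)] at hL
  have hanti : Antitone fun n : ℕ => ((1 / 8 : ℝ) ^ n / (2 * n + 1)) := by
    refine antitone_nat_of_succ_le fun n => ?_
    apply div_le_div₀ (by positivity) _ (by positivity) (by push_cast; linarith)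
    exact pow_le_pow_of_le_one (by norm_num) (by norm_num) (Nat.le_succ n)
  have h1 := hanti.alternating_series_le_tendsto hL 10
  have h2 := hanti.tendsto_le_alternating_series hL 10
  have hA : Real.arctan (s / 2) = s / 2 * ((s / 2)⁻¹ * Real.arctan (s / 2)) := by
    rw [mul_inv_cancel_left₀ (show s / 2 ≠ 0 by positivity)]
  generalize (s / 2)⁻¹ * Real.arctan (s / 2) = L at *
  norm_num [Finset.sum_range_succ] at h1 h2
  rw [hA]
  constructor
  · refine lt_of_lt_of_le ?_ (mul_le_mul (div_le_div_of_nonneg_right hlo.le zero_le_two) h1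
      (by norm_num) (by positivity))
    norm_num
  · refine lt_of_le_of_lt (mul_le_mul (div_le_div_of_nonneg_right hhi.le zero_le_two) h2
      (le_trans (by norm_num) h1) (by norm_num)) ?_
    norm_num

theorem meanWidth_value_bounds :
    1.006582094946935 ≤ (16 * Real.pi - (36 - √3 * Real.pi) * arcsec 3) / (4 * Real.pi) ∧
    (16 * Real.pi - (36 - √3 * Real.pi) * arcsec 3) / (4 * Real.pi) < 1.006582094946936 := by
  have h1 := arctan_inv_sqrt_two_half_bounds
  rw [arctan_inv_sqrt_two_half] at h1
  have p1 := Real.pi_gt_d20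
  have p2 := Real.pi_lt_d20
  have r1 : 1.73205080756887729352 < √3 := Real.lt_sqrt_of_sq_lt (by norm_num)
  have r2 : √3 < 1.73205080756887729353 := by
    rw [Real.sqrt_lt' (by norm_num)]; norm_num
  have t1 : 1.230959417340774682 < Real.arccos (1 / 3) := by linarith
  have t2 : Real.arccos (1 / 3) < 1.2309594173407746823 := by linarith
  -- In this form the value is monotone in each of `arccos (1 / 3)`, `9 / π` and `√3`, in the
  -- relevant range, so interval bounds can be inserted separately.
  have e : (16 * Real.pi - (36 - √3 * Real.pi) * arcsec 3) / (4 * Real.pi) =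
      4 - Real.arccos (1 / 3) * (9 / Real.pi - √3 / 4) := by
    rw [arcsec]
    field_simp
    ring
  have q1 : 9 / Real.pi < 9 / 3.14159265358979323846 := by gcongr
  have q2 : 9 / 3.14159265358979323847 < 9 / Real.pi := by gcongr
  rw [e]
  generalize Real.arccos (1 / 3) = t at *
  generalize 9 / Real.pi = q at *
  generalize √3 = r at *
  constructor
  · have : t * (q - r / 4) ≤ 1.2309594173407746823 *
        (9 / 3.14159265358979323846 - 1.73205080756887729352 / 4) := by
      apply mul_le_mul t2.le (by linarith) (by norm_num at *; linarith) (by norm_num)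
    norm_num at *
    linarith
  · have : 1.230959417340774682 *
        (9 / 3.14159265358979323847 - 1.73205080756887729353 / 4) ≤ t * (q - r / 4) := by
      apply mul_le_mul t1.le (by linarith) (by norm_num) (by norm_num at *; linarith)
    norm_num at *
    linarith

theorem mainTheorem1 (c : Fin 4 → E3) (hc : ∀ i j, i ≠ j → dist (c i) (c j) = 1) :
    meanWidth (ballIntersection c)
        = (16 * Real.pi - (36 - √3 * Real.pi) * arcsec 3) / (4 * Real.pi) ∧
    1.006582094946935 ≤ meanWidth (ballIntersection c) ∧
    meanWidth (ballIntersection c) < 1.006582094946936 ∧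
    IsLeast (width (ballIntersection c) '' Metric.sphere 0 1) 1 ∧
    IsGreatest (width (ballIntersection c) '' Metric.sphere 0 1) (√3 - 1 / √2) ∧
    1 < meanWidth (ballIntersection c) ∧
    meanWidth (ballIntersection c) < √3 - 1 / √2 := by
  obtain ⟨h1, h2⟩ := meanWidth_value_bounds
  rw [one_div √2]
  refine ⟨meanWidth_eq hc, ?_, ?_, isLeast_width hc, isGreatest_width hc, ?_, ?_⟩
  all_goals rw [meanWidth_eq hc]
  · exact h1
  · exact h2
  · refine lt_of_lt_of_le ?_ h1
    norm_num
  · refine h2.trans ?_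
    have hr1 : 1.732 ≤ √3 := Real.le_sqrt_of_sq_le (by norm_num)
    have hs : (√2)⁻¹ ≤ 0.71 := by
      rw [inv_le_comm₀ (by positivity) (by norm_num)]
      apply Real.le_sqrt_of_sq_le
      norm_num
    linarith
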